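/- All rings are commutative with $1\neq 0$. Let $R$ be a ring. An ideal is regular if it contains a nonzerodivisor, and an ideal $I$ is invertible if $IJ=R$ for some $R$-submodule $J$ of the total quotient ring of $R$. $R$ is an SP-ring if every regular ideal of $R$ is a product of radical ideals, and a Prüfer ring if every finitely generated regular ideal of $R$ is invertible. Let $\mathrm{Max}^{-1}_{\mathrm{reg}}(R)$ be the set of maximal regular ideals of $R$ with the inverse topology, which has as a basis of open sets the sets $\{M : I\subseteq M\}$, where $I$ is a finitely generated regular ideal. For a Hausdorff space $X$, let $U(X)$ be the monoid, under pointwise addition, of compactly supported upper semicontinuous functions $f:X\to\mathbb{N}_0$, ordered by $f\le g$ iff $f(x)\ge g(x)$ for all $x\in X$, and let $U_b(X)=U(X)\cup\{b\}$, where $b$ is a new least element with $b+f=f+b=b$ for all $f \in U_b(X)$. (The space $\mathrm{Max}^{-1}_{\mathrm{reg}}(R)$ is always Hausdorff.) Suppose that every regular ideal of $R$ is a (possibly infinite) sum of invertible ideals. Then the following are equivalent. 1. $R$ is an SP-ring. 2. Each regular ideal $I$ of $R$ can be written as $I=J_1\cdots J_n$ with $n\ge 0$ and proper radical ideals $J_1\subseteq\cdots\subseteq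 J_n$, and $n,J_1,\ldots,J_n$ are uniquely determined by $I$ (the empty product being $R$). 3. Every regular prime ideal of $R$ is maximal, and every invertible ideal of $R$ is a product of radical ideals of $R$. 4. Each regular prime ideal of $R$ is maximal and contains an invertible radical ideal. 5. The radical of each finitely generated regular ideal of $R$ is invertible. 6. The multiplicative lattice consisting of the regular ideals of $R$ and the zero ideal, ordered by inclusion and with multiplication of ideals, is isomorphic, as an ordered monoid, to $U_b(\mathrm{Max}^{-1}_{\mathrm{reg}}(R))$. 7. $R$ is a Prüfer ring for which the radical of each finitely generated regular ideal is finitely generated. -/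

import Mathlib

open scoped nonZeroDivisors

/-- An ideal is regular if it contains a nonzerodivisor. -/
def IsRegularIdeal {R : Type*} [CommRing R] (I : Ideal R) : Prop :=
  ∃ x ∈ I, x ∈ R⁰

/-- An ideal `I` of `R` is invertible if `I * J = R` for some `R`-submodule `J` of the total
quotient ring of `R`. (`FractionRing R` is the localization of `R` at all nonzerodivisors, for
every commutative ring `R`.) -/
def IsInvertibleIdeal {R : Type*} [CommRing R] (I : Ideal R) : Prop :=
  ∃ J : Submodule R (FractionRing R), IsLocalization.coeSubmodule (FractionRing R) I * J = 1

/-- `I` is a sum of a (possibly infinite) family of invertible ideals. -/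
def IsSumOfInvertibleIdeals {R : Type*} [CommRing R] (I : Ideal R) : Prop :=
  ∃ S : Set (Ideal R), (∀ J ∈ S, IsInvertibleIdeal J) ∧ I = sSup S

/-- `I` is a finite product of radical ideals. (The ideal `R` is radical, and it is also the empty
product.) -/
def IsProductOfRadicalIdeals {R : Type*} [CommRing R] (I : Ideal R) : Prop :=
  ∃ s : Multiset (Ideal R), (∀ J ∈ s, J.IsRadical) ∧ s.prod = I

/-- The list `J₁, …, Jₙ` is a chain `J₁ ⊆ ⋯ ⊆ Jₙ` of proper radical ideals with product `I`.
The empty list is allowed; its product is `R`. -/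
def IsRadicalChainFactorization {R : Type*} [CommRing R] (I : Ideal R) (l : List (Ideal R)) :
    Prop :=
  l.Pairwise (· ≤ ·) ∧ (∀ J ∈ l, J.IsRadical ∧ J ≠ ⊤) ∧ l.prod = I

/-- An SP-ring is a ring in which every regular ideal is a product of radical ideals. -/
def IsSPRing (R : Type*) [CommRing R] : Prop :=
  ∀ I : Ideal R, IsRegularIdeal I → IsProductOfRadicalIdeals I

/-- A Prüfer ring is a ring in which every finitely generated regular ideal is invertible. -/
def IsPruferRing (R : Type*) [CommRing R] : Prop :=
  ∀ I : Ideal R, I.FG → IsRegularIdeal I → IsInvertibleIdeal I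

/-- The multiplicative lattice consisting of the regular ideals and the zero ideal: its
multiplication is the product of ideals and its order is inclusion. -/
def regularOrZeroIdeals (R : Type*) [CommRing R] : Submonoid (Ideal R) where
  carrier := {I | IsRegularIdeal I ∨ I = ⊥}
  one_mem' := Or.inl ⟨1, by simp, one_mem _⟩
  mul_mem' := by
    rintro I J (⟨x, hx, hx'⟩ | rfl) (⟨y, hy, hy'⟩ | rfl)
    · exact Or.inl ⟨x * y, Ideal.mul_mem_mul hx hy, mul_mem hx' hy'⟩
    all_goals exact Or.inr (by simp)

/-- The set of maximal regular ideals of `R`. (Ideals containing a regular ideal are regular, so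
these are the maximal ideals that are regular.) -/
def MaxReg (R : Type*) [CommRing R] : Type _ :=
  {M : Ideal R // M.IsMaximal ∧ IsRegularIdeal M}

/-- The inverse topology on the maximal regular ideals: the topology with the sets
`V(I) = {M | I ⊆ M}`, `I` a finitely generated regular ideal, as a basis of open sets. -/
instance MaxReg.inverseTopology (R : Type*) [CommRing R] : TopologicalSpace (MaxReg R) :=
  TopologicalSpace.generateFrom
    {V | ∃ I : Ideal R, I.FG ∧ IsRegularIdeal I ∧ V = {M : MaxReg R | I ≤ M.1}}

/-- The monoid `U(X)` of compactly supported upper semicontinuous functions `X → ℕ`, with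
pointwise addition. -/
def uscCompactlySupported (X : Type*) [TopologicalSpace X] : AddSubmonoid (X → ℕ) where
  carrier := {f | UpperSemicontinuous f ∧ HasCompactSupport f}
  zero_mem' := ⟨upperSemicontinuous_const, HasCompactSupport.zero⟩
  add_mem' := fun hf hg => ⟨hf.1.add hg.1, hf.2.add hg.2⟩

/-- `U_b(X)`: the monoid `U(X)`, with the dual `f ≤ g ↔ ∀ x, g x ≤ f x` of the pointwise order,
together with a new bottom element `b` satisfying `b + f = f + b = b`. -/
abbrev UscWithBot (X : Type*) [TopologicalSpace X] : Type _ :=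
  WithBot (uscCompactlySupported X)ᵒᵈ

/-! ### Invertible ideals: cancellation, division, the local case. -/

section Invertible

variable {R : Type*} [CommRing R] {I J A B : Ideal R}

/-! The hub is condition 4, named `HasInvertibleRadicalIdeals`. Under it, let M be a maximal regular
ideal. The maximal ideal of R_M is the extension of an invertible radical ideal, hence is generated
by one nonzerodivisor, and M is minimal over every regular ideal inside it. So each regular ideal
extends to a power of the maximal ideal of R_M. The exponents `MaxReg.val` turn products into sums,
finite sums of ideals into minima and inclusion into the reversed pointwise order; maximal ideals
that are not regular do not matter, because regular ideals become trivial there.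

Thus regular ideals are functions on `MaxReg R`, and the radical ones are those with values at most
1. The Prüfer property allows division by finitely generated regular ideals, which realises
differences and maxima of exponents. This shows that the functions obtained are exactly the
compactly supported upper semicontinuous ones (`val_mem_uscCompactlySupported`, `exists_val_eq`),
whence 6, and that radicals of finitely generated regular ideals are invertible, whence 7. The
identity f = min(f, 1) + (f - 1) splits off the radical and gives 2.

For the way back to 4, the difficulty is that regular primes are maximal. From 1 this is
`IsSPRing.isMaximal_of_isPrime`, which rests on the local computation `false_of_colon_le_sup_sq`;
from 5 it is a short argument with invertible radicals. From 6, functions bounded by 1 must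
correspond to radical ideals, which yields 1. -/

theorem IsRegularIdeal.mono (h : IsRegularIdeal I) (hIJ : I ≤ J) : IsRegularIdeal J :=
  let ⟨x, hx, hx'⟩ := h
  ⟨x, hIJ hx, hx'⟩

theorem IsRegularIdeal.mul (hI : IsRegularIdeal I) (hJ : IsRegularIdeal J) :
    IsRegularIdeal (I * J) :=
  let ⟨x, hx, hx'⟩ := hI
  let ⟨y, hy, hy'⟩ := hJ
  ⟨x * y, Ideal.mul_mem_mul hx hy, mul_mem hx' hy'⟩

theorem isRegularIdeal_top : IsRegularIdeal (⊤ : Ideal R) := ⟨1, trivial, one_mem _⟩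

theorem IsRegularIdeal.pow (hI : IsRegularIdeal I) (n : ℕ) : IsRegularIdeal (I ^ n) :=
  let ⟨x, hx, hx'⟩ := hI
  ⟨x ^ n, Ideal.pow_mem_pow hx n, pow_mem hx' n⟩

theorem isRegularIdeal_span_singleton {d : R} (hd : d ∈ R⁰) : IsRegularIdeal (Ideal.span {d}) :=
  ⟨d, Ideal.mem_span_singleton_self d, hd⟩

theorem not_isRegularIdeal_bot [Nontrivial R] : ¬ IsRegularIdeal (⊥ : Ideal R) := by
  rintro ⟨x, hx, hx'⟩
  exact nonZeroDivisors.ne_zero hx' ((Submodule.mem_bot R).1 hx)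

theorem IsInvertibleIdeal.isRegularIdeal (h : IsInvertibleIdeal I) : IsRegularIdeal I := by
  obtain ⟨J, hJ⟩ := h
  have key : ∀ z ∈ IsLocalization.coeSubmodule (FractionRing R) I * J,
      ∃ d ∈ R⁰, d • z ∈ IsLocalization.coeSubmodule (FractionRing R) I := by
    intro z hz
    induction hz using Submodule.mul_induction_on' with
    | mem_mul_mem a ha b hb =>
      obtain ⟨⟨r, d⟩, hrd⟩ := IsLocalization.surj R⁰ b
      refine ⟨d, d.2, ?_⟩
      have : (d : R) • (a * b) = r • a := by
        rw [Algebra.smul_def, Algebra.smul_def, ← hrd]; ring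
      rw [this]
      exact Submodule.smul_mem _ _ ha
    | add x _ y _ hx hy =>
      obtain ⟨d, hd, hdx⟩ := hx
      obtain ⟨e, he, hey⟩ := hy
      refine ⟨d * e, mul_mem hd he, ?_⟩
      rw [smul_add]
      refine add_mem ?_ ?_
      · rw [mul_comm, mul_smul]; exact Submodule.smul_mem _ _ hdx
      · rw [mul_smul]; exact Submodule.smul_mem _ _ hey
  obtain ⟨d, hd, h1⟩ := key 1 (by rw [hJ]; exact Submodule.one_le.1 le_rfl)
  obtain ⟨y, hy, hyd⟩ := (IsLocalization.mem_coeSubmodule _ _).1 h1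
  rw [Algebra.smul_def, mul_one] at hyd
  have : y = d := IsFractionRing.injective R (FractionRing R) hyd
  exact ⟨d, this ▸ hy, hd⟩

/-- Invertibility expressed inside the ring: some multiple is principal with regular generator. -/
theorem isInvertibleIdeal_iff :
    IsInvertibleIdeal I ↔ ∃ J : Ideal R, ∃ d ∈ R⁰, I * J = Ideal.span {d} := by
  constructor
  · intro h
    obtain ⟨d, hdI, hd⟩ := h.isRegularIdeal
    obtain ⟨J, hJ⟩ := h
    have hmem : ∀ b ∈ J, ∀ y ∈ I, ∃ r : R, algebraMap R (FractionRing R) r =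
        algebraMap R (FractionRing R) y * b := by
      intro b hb y hy
      have : algebraMap R (FractionRing R) y * b ∈ (1 : Submodule R (FractionRing R)) := by
        rw [← hJ]
        exact Submodule.mul_mem_mul ((IsLocalization.mem_coeSubmodule _ _).2 ⟨y, hy, rfl⟩) hb
      exact Submodule.mem_one.1 this
    let J' : Ideal R := (J.map (LinearMap.mulLeft R (algebraMap R (FractionRing R) d))).comap
      (Algebra.linearMap R (FractionRing R))
    have hJ' : IsLocalization.coeSubmodule (FractionRing R) J' =
        Submodule.span R {algebraMap R (FractionRing R) d} * J := by
      ext z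
      rw [IsLocalization.mem_coeSubmodule, Submodule.mem_span_singleton_mul]
      constructor
      · rintro ⟨y, ⟨b, hb, hby⟩, rfl⟩
        exact ⟨b, hb, hby⟩
      · rintro ⟨b, hb, rfl⟩
        obtain ⟨r, hr⟩ := hmem b hb d hdI
        exact ⟨r, ⟨b, hb, hr.symm⟩, hr⟩
    refine ⟨J', d, hd, ?_⟩
    apply IsLocalization.coeSubmodule_injective (FractionRing R) (le_refl R⁰)
    rw [IsLocalization.coeSubmodule_mul, hJ', IsLocalization.coeSubmodule_span_singleton,
      mul_left_comm, hJ, mul_one]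
  · rintro ⟨J, d, hd, h⟩
    refine ⟨IsLocalization.coeSubmodule (FractionRing R) J *
      Submodule.span R {IsLocalization.mk' (FractionRing R) 1 (⟨d, hd⟩ : R⁰)}, ?_⟩
    rw [← mul_assoc, ← IsLocalization.coeSubmodule_mul, h,
      IsLocalization.coeSubmodule_span_singleton, Submodule.span_mul_span, Set.singleton_mul_singleton,
      Submodule.one_eq_span]
    congr 2
    exact IsLocalization.mk'_spec' (FractionRing R) 1 (⟨d, hd⟩ : R⁰) |>.trans (map_one _)

theorem IsInvertibleIdeal.fg (h : IsInvertibleIdeal I) : I.FG := by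
  obtain ⟨J, hJ⟩ := h
  exact (IsLocalization.coeSubmodule_fg (FractionRing R)
    (IsFractionRing.injective R (FractionRing R)) I).1
    (Submodule.fg_of_isUnit (IsUnit.of_mul_eq_one _ hJ))

theorem isInvertibleIdeal_span_singleton {d : R} (hd : d ∈ R⁰) :
    IsInvertibleIdeal (Ideal.span {d}) :=
  isInvertibleIdeal_iff.2 ⟨⊤, d, hd, Ideal.mul_top _⟩

theorem isInvertibleIdeal_top : IsInvertibleIdeal (⊤ : Ideal R) :=
  isInvertibleIdeal_iff.2 ⟨⊤, 1, one_mem _, by simp⟩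

theorem IsInvertibleIdeal.of_mul_left (h : IsInvertibleIdeal (I * J)) : IsInvertibleIdeal I := by
  obtain ⟨K, d, hd, hK⟩ := isInvertibleIdeal_iff.1 h
  exact isInvertibleIdeal_iff.2 ⟨J * K, d, hd, by rw [← mul_assoc, hK]⟩

theorem IsInvertibleIdeal.of_mul_right (h : IsInvertibleIdeal (I * J)) : IsInvertibleIdeal J :=
  (mul_comm I J ▸ h).of_mul_left

theorem IsInvertibleIdeal.mul (hI : IsInvertibleIdeal I) (hJ : IsInvertibleIdeal J) :
    IsInvertibleIdeal (I * J) := by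
  obtain ⟨K, d, hd, hK⟩ := isInvertibleIdeal_iff.1 hI
  obtain ⟨L, e, he, hL⟩ := isInvertibleIdeal_iff.1 hJ
  exact isInvertibleIdeal_iff.2 ⟨K * L, d * e, mul_mem hd he, by
    rw [mul_mul_mul_comm, hK, hL, Ideal.span_singleton_mul_span_singleton]⟩

theorem IsInvertibleIdeal.pow (hI : IsInvertibleIdeal I) (n : ℕ) : IsInvertibleIdeal (I ^ n) := by
  induction n with
  | zero => simpa using isInvertibleIdeal_top
  | succ n ih => rw [pow_succ]; exact ih.mul hI

theorem span_singleton_mul_le_cancel {d : R} (hd : d ∈ R⁰)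
    (h : Ideal.span {d} * A ≤ Ideal.span {d} * B) : A ≤ B := by
  intro a ha
  obtain ⟨b, hb, hab⟩ := Ideal.mem_span_singleton_mul.1
    (h (Ideal.mul_mem_mul (Ideal.mem_span_singleton_self d) ha))
  have : b = a := mul_cancel_left_mem_nonZeroDivisors hd |>.1 hab
  exact this ▸ hb

theorem IsInvertibleIdeal.le_of_mul_le_mul (hI : IsInvertibleIdeal I) (h : I * A ≤ I * B) :
    A ≤ B := by
  obtain ⟨K, d, hd, hK⟩ := isInvertibleIdeal_iff.1 hI
  apply span_singleton_mul_le_cancel hd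
  rw [← hK, mul_comm I K, mul_assoc, mul_assoc]
  exact Ideal.mul_mono_right h

/-- To contain is to divide: if IK = (d), then AK lies in (d), so AK = dE, and cancelling d from dA
= dIE leaves A = IE. -/
theorem IsInvertibleIdeal.dvd (hI : IsInvertibleIdeal I) (h : A ≤ I) : I ∣ A := by
  obtain ⟨K, d, hd, hK⟩ := isInvertibleIdeal_iff.1 hI
  have hAK : A * K ≤ Ideal.span {d} := hK ▸ Ideal.mul_mono_left h
  obtain ⟨E, hE⟩ : ∃ E : Ideal R, A * K = Ideal.span {d} * E := by
    refine ⟨Submodule.comap (LinearMap.mulLeft R d) (A * K), le_antisymm ?_ ?_⟩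
    · intro y hy
      obtain ⟨e, rfl⟩ := Ideal.mem_span_singleton.1 (hAK hy)
      exact Ideal.mul_mem_mul (Ideal.mem_span_singleton_self d) hy
    · rw [Ideal.span_singleton_mul_le_iff]
      exact fun z hz => hz
  refine ⟨E, ?_⟩
  have : Ideal.span {d} * A = Ideal.span {d} * (I * E) := by
    rw [mul_left_comm, ← hE, ← hK]; ring
  exact le_antisymm (span_singleton_mul_le_cancel hd this.le)
    (span_singleton_mul_le_cancel hd this.ge)

/-- In a local ring, an ideal with a multiple that is principal on a regular generator is itself
principal on a regular generator. -/
theorem exists_eq_span_singleton_of_mul_eq_span_singleton [IsLocalRing R] {d : R} (hd : d ∈ R⁰)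
    (h : I * J = Ideal.span {d}) : ∃ c ∈ R⁰, I = Ideal.span {c} := by
  -- Otherwise every product lies in d times the maximal ideal, and cancelling d makes the maximal
  -- ideal everything.
  have hex : ∃ a ∈ I, ∃ b ∈ J, ∃ u : Rˣ, a * b = u * d := by
    by_contra! hcon
    have : I * J ≤ Ideal.span {d} * IsLocalRing.maximalIdeal R := by
      rw [Ideal.mul_le]
      intro a ha b hb
      obtain ⟨r, hr⟩ := Ideal.mem_span_singleton.1 (h ▸ Ideal.mul_mem_mul ha hb)
      rw [hr]
      refine Ideal.mul_mem_mul (Ideal.mem_span_singleton_self d) ?_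
      rw [IsLocalRing.mem_maximalIdeal, mem_nonunits_iff]
      rintro ⟨u, rfl⟩
      exact hcon a ha b hb u (hr.trans (mul_comm _ _))
    have h2 := span_singleton_mul_le_cancel (A := ⊤) (B := IsLocalRing.maximalIdeal R) hd
      (by rw [Ideal.mul_top]; exact h.symm.le.trans this)
    exact (IsLocalRing.maximalIdeal.isMaximal R).ne_top (top_le_iff.1 h2)
  obtain ⟨a, ha, b, hb, u, hab⟩ := hex
  have ha0 : a ∈ R⁰ := (mul_mem_nonZeroDivisors.1 (hab ▸ mul_mem u.isUnit.mem_nonZeroDivisors hd)).1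
  refine ⟨a, ha0, le_antisymm ?_ ((Ideal.span_singleton_le_iff_mem _).2 ha)⟩
  intro y hy
  obtain ⟨w, hw⟩ := Ideal.mem_span_singleton.1 (h ▸ Ideal.mul_mem_mul hy hb)
  refine Ideal.mem_span_singleton.2 ⟨w * ↑u⁻¹, ?_⟩
  have : d * (y * u) = d * (a * w) := by
    calc d * (y * u) = y * (u * d) := by ring
      _ = y * (a * b) := by rw [hab]
      _ = a * (y * b) := by ring
      _ = d * (a * w) := by rw [hw]; ring
  have h3 := (mul_cancel_left_mem_nonZeroDivisors hd).1 this
  calc y = y * u * ↑u⁻¹ := by simp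
    _ = _ := by rw [h3, mul_assoc]

theorem isRadical_of_sq_le (h : ∀ x : R, x ^ 2 ∈ I → x ∈ I) : I.IsRadical := by
  rintro x ⟨n, hn⟩
  induction n using Nat.strong_induction_on generalizing x with
  | _ n ih =>
    rcases Nat.lt_or_ge n 2 with h2 | h2
    · interval_cases n
      · rw [pow_zero] at hn; simpa using I.mul_mem_left x hn
      · simpa using hn
    -- The exponent is n/2 rounded up: its double is at least n.
    · refine ih ((n + 1) / 2) (by omega) (h _ ?_)
      rw [← pow_mul]
      exact I.pow_mem_of_pow_mem hn (by omega)

end Invertible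

/-! ### Regular primes of SP-rings are maximal. -/

section Dimension

theorem IsLocalRing.isUnit_one_sub {S : Type*} [CommRing S] [IsLocalRing S] {x : S}
    (hx : x ∈ IsLocalRing.maximalIdeal S) : IsUnit (1 - x) :=
  IsLocalRing.isUnit_one_sub_self_of_mem_nonunits x hx

/-- Here K = (c) : a. Since c lies in K, it can be written c = a²x + ay + z with y in K and z in K²,
and ay = cw. The cases are w a unit and w a nonunit. -/
theorem false_of_colon_le_sup_sq {S : Type*} [CommRing S] [IsLocalRing S] {a c : S} {K : Ideal S}
    (hc : c ∈ S⁰) (hrad : (Ideal.span {c}).IsRadical) (ha : a ∈ IsLocalRing.maximalIdeal S)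
    (hac : a ∉ Ideal.span {c}) (hK : ∀ y, y ∈ K ↔ a * y ∈ Ideal.span {c})
    (hle : K ≤ (Ideal.span {a} ⊔ K) ^ 2) : False := by
  have hKm : K ≤ IsLocalRing.maximalIdeal S := by
    intro y hy
    rw [IsLocalRing.mem_maximalIdeal, mem_nonunits_iff]
    intro hu
    exact hac ((Ideal.mul_unit_mem_iff_mem _ hu).1 ((hK y).1 hy))
  have hdec : ∀ t ∈ K, ∃ x, ∃ y ∈ K, ∃ z ∈ K * K, t = a * a * x + a * y + z := by
    intro t ht
    have h1 : (Ideal.span {a} ⊔ K) ^ 2 ≤ Ideal.span {a * a} ⊔ (Ideal.span {a} * K ⊔ K * K) := by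
      rw [sq, Ideal.sup_mul, Ideal.mul_sup, Ideal.mul_sup, Ideal.span_singleton_mul_span_singleton,
        mul_comm K (Ideal.span {a})]
      refine sup_le (sup_le le_sup_left ?_) (sup_le ?_ ?_)
      · exact le_sup_left.trans le_sup_right
      · exact le_sup_left.trans le_sup_right
      · exact le_sup_right.trans le_sup_right
    obtain ⟨p, hp, q, hq, rfl⟩ := Submodule.mem_sup.1 (h1 (hle ht))
    obtain ⟨r, hr, z, hz, rfl⟩ := Submodule.mem_sup.1 hq
    obtain ⟨x, rfl⟩ := Ideal.mem_span_singleton.1 hp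
    obtain ⟨y, hy, rfl⟩ := Ideal.mem_span_singleton_mul.1 hr
    exact ⟨x, y, hy, z, hz, by ring⟩
  have hcube : ∀ x, a * (a * (a * x)) ∈ Ideal.span {c} → a * x ∈ Ideal.span {c} := by
    intro x hx
    refine hrad ⟨3, ?_⟩
    have : (a * x) ^ 3 = x ^ 2 * (a * (a * (a * x))) := by ring
    rw [this]
    exact Ideal.mul_mem_left _ _ hx
  have hcK : c ∈ K := (hK c).2 (Ideal.mul_mem_left _ _ (Ideal.mem_span_singleton_self c))
  obtain ⟨x, y, hy, z, hz, hxyz⟩ := hdec c hcK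
  obtain ⟨w, hw⟩ := Ideal.mem_span_singleton.1 ((hK y).1 hy)
  by_cases hwu : IsUnit w
  -- Now a is regular and K = (y). Expanding y in the same way gives y = a²x' with x' in K by
  -- radicality, so y is a multiple of a²y; hence y = 0 and c = 0.
  · obtain ⟨u, rfl⟩ := hwu
    have hcu : c = a * y * ↑u⁻¹ := by rw [hw, mul_assoc, Units.mul_inv, mul_one]
    have ha0 : a ∈ S⁰ := by
      rw [hcu, mul_mem_nonZeroDivisors, mul_mem_nonZeroDivisors] at hc
      exact hc.1.1
    have hKy : ∀ t ∈ K, y ∣ t := by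
      intro t ht
      obtain ⟨e, he⟩ := Ideal.mem_span_singleton.1 ((hK t).1 ht)
      refine ⟨↑u⁻¹ * e, (mul_cancel_left_mem_nonZeroDivisors ha0).1 ?_⟩
      rw [he, hcu]; ring
    obtain ⟨x1, y1, hy1, z1, hz1, h1⟩ := hdec y hy
    obtain ⟨r, rfl⟩ := hKy y1 hy1
    have hz1' : z1 ∈ Ideal.span {y} * Ideal.span {y} := by
      refine Ideal.mul_mono ?_ ?_ hz1 <;>
        exact fun t ht => Ideal.mem_span_singleton.2 (hKy t ht)
    rw [Ideal.span_singleton_mul_span_singleton, Ideal.mem_span_singleton] at hz1'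
    obtain ⟨s, rfl⟩ := hz1'
    obtain ⟨v, hv⟩ := IsLocalRing.isUnit_one_sub
      (add_mem (Ideal.mul_mem_right r _ ha) (Ideal.mul_mem_right s _ (hKm hy)))
    have h2 : y = a * a * (x1 * ↑v⁻¹) := by
      have : y * v = a * a * x1 := by rw [hv]; linear_combination h1
      rw [← mul_assoc, ← this, mul_assoc, Units.mul_inv, mul_one]
    have h3 : x1 * ↑v⁻¹ ∈ K := by
      rw [hK]
      apply hcube
      have := (hK y).1 hy
      rw [h2] at this
      convert! this using 1
      ring
    obtain ⟨r', hr'⟩ := hKy _ h3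
    rw [hr'] at h2
    obtain ⟨v', hv'⟩ := IsLocalRing.isUnit_one_sub (Ideal.mul_mem_right (a * r') _ ha)
    have hy0 : y * v' = 0 := by rw [hv']; linear_combination h2
    rw [Units.mul_left_eq_zero] at hy0
    rw [hy0] at hcu
    exact nonZeroDivisors.ne_zero hc (by rw [hcu]; ring)
  -- Here c(1 - w) = a²x + z. Radicality gives ax = cw', and aK ⊆ (c) gives a²z = c²s. Multiplying
  -- by a² and cancelling c puts a² times a unit in (c), so a is in (c).
  · obtain ⟨v, hv⟩ := IsLocalRing.isUnit_one_sub
      ((IsLocalRing.mem_maximalIdeal w).2 (mem_nonunits_iff.2 hwu))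
    have h1 : c * v = a * a * x + z := by rw [hv]; linear_combination hxyz + hw
    have haz : a * z ∈ Ideal.span {c} := (hK z).1 (Ideal.mul_le_left hz)
    have hax : a * x ∈ Ideal.span {c} := by
      apply hcube
      have : a * (a * (a * x)) = a * v * c - a * z := by linear_combination (-a) * h1
      rw [this]
      exact sub_mem (Ideal.mul_mem_left _ _ (Ideal.mem_span_singleton_self c)) haz
    obtain ⟨w', hw'⟩ := Ideal.mem_span_singleton.1 hax
    have hzz : a * a * z ∈ Ideal.span {c * c} := by
      have : Ideal.span {a * a} * (K * K) ≤ Ideal.span {c * c} := by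
        rw [← Ideal.span_singleton_mul_span_singleton, mul_mul_mul_comm,
          ← Ideal.span_singleton_mul_span_singleton]
        refine Ideal.mul_mono ?_ ?_ <;>
          exact Ideal.span_singleton_mul_le_iff.2 fun t ht => (hK t).1 ht
      exact this (Ideal.mul_mem_mul (Ideal.mem_span_singleton_self _) hz)
    obtain ⟨s, hs⟩ := Ideal.mem_span_singleton.1 hzz
    obtain ⟨v', hv'⟩ : IsUnit ((v : S) - a * w') := by
      by_contra hcon
      have h2 : (v : S) ∈ IsLocalRing.maximalIdeal S := by
        rw [← sub_add_cancel (v : S) (a * w')]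
        exact add_mem ((IsLocalRing.mem_maximalIdeal _).2 (mem_nonunits_iff.2 hcon))
          (Ideal.mul_mem_right w' _ ha)
      exact (mem_nonunits_iff.1 ((IsLocalRing.mem_maximalIdeal _).1 h2)) v.isUnit
    have h2 : c * (a * a * v') = c * (c * s) := by
      rw [hv']; linear_combination a * a * h1 + hs + a * a * a * hw'
    have h3 := (mul_cancel_left_mem_nonZeroDivisors hc).1 h2
    refine hac (hrad ⟨2, Ideal.mem_span_singleton.2 ⟨s * ↑v'⁻¹, ?_⟩⟩)
    rw [← mul_assoc, ← h3, mul_assoc, Units.mul_inv]; ring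

variable {R : Type*} [CommRing R]

/-- A regular prime containing a product of radical ideals that equals a principal regular ideal
contains an invertible radical ideal. -/
theorem exists_isRadical_isInvertibleIdeal_le {P : Ideal R} (hP : P.IsPrime) {x : R} (hx : x ∈ P)
    (hx0 : x ∈ R⁰) (h : IsProductOfRadicalIdeals (Ideal.span {x})) :
    ∃ J : Ideal R, J ≤ P ∧ IsInvertibleIdeal J ∧ J.IsRadical := by
  obtain ⟨s, hs, hsx⟩ := h
  obtain ⟨J, hJs, hJP⟩ := hP.multiset_prod_le.1
    (hsx.le.trans ((Ideal.span_singleton_le_iff_mem _).2 hx))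
  refine ⟨J, hJP, ?_, hs J hJs⟩
  obtain ⟨t, rfl⟩ := Multiset.exists_cons_of_mem hJs
  rw [Multiset.prod_cons] at hsx
  exact IsInvertibleIdeal.of_mul_left (hsx ▸ isInvertibleIdeal_span_singleton hx0)

/-- Every radical factor of I contains L. If it lies in Q, then Q is minimal over it and it extends
to the maximal ideal; otherwise it extends to the whole ring. -/
theorem map_eq_maximalIdeal_pow_of_isProductOfRadicalIdeals {Q I L : Ideal R} [Q.IsPrime]
    (hQ : Q ∈ L.minimalPrimes) (hLI : L ≤ I.radical) (h : IsProductOfRadicalIdeals I) :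
    ∃ n, I.map (algebraMap R (Localization.AtPrime Q)) =
      IsLocalRing.maximalIdeal (Localization.AtPrime Q) ^ n := by
  obtain ⟨s, hs, rfl⟩ := h
  have key : ∀ J ∈ s, ∃ n, J.map (algebraMap R (Localization.AtPrime Q)) =
      IsLocalRing.maximalIdeal (Localization.AtPrime Q) ^ n := by
    intro J hJ
    have hLJ : L ≤ J := hLI.trans ((Ideal.radical_mono
      (Ideal.multiset_prod_le_inf.trans (Multiset.inf_le hJ))).trans (hs J hJ))
    by_cases hJQ : J ≤ Q
    · refine ⟨1, ?_⟩
      have hQJ : Q ∈ J.minimalPrimes :=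
        ⟨⟨hQ.1.1, hJQ⟩, fun p hp hpQ => hQ.2 ⟨hp.1, hLJ.trans hp.2⟩ hpQ⟩
      rw [pow_one, ← IsLocalization.AtPrime.map_eq_maximalIdeal Q,
        ← IsLocalization.AtPrime.radical_map_of_mem_minimalPrimes _ Q J hQJ,
        ← IsLocalization.map_radical Q.primeCompl, (hs J hJ).radical]
    · refine ⟨0, ?_⟩
      rw [pow_zero, Ideal.one_eq_top]
      obtain ⟨x, hxJ, hxQ⟩ := SetLike.not_le_iff_exists.1 hJQ
      exact Ideal.eq_top_of_isUnit_mem _ (Ideal.mem_map_of_mem _ hxJ)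
        ((IsLocalization.AtPrime.isUnit_to_map_iff _ Q x).2 hxQ)
  clear hLI hs
  induction s using Multiset.induction_on with
  | empty => exact ⟨0, by simp [Ideal.one_eq_top, Ideal.map_top]⟩
  | cons J s ih =>
    obtain ⟨n, hn⟩ := ih fun K hK => key K (Multiset.mem_cons_of_mem hK)
    obtain ⟨m, hm⟩ := key J (Multiset.mem_cons_self J s)
    exact ⟨m + n, by rw [Multiset.prod_cons, Ideal.map_mul, hn, hm, pow_add]⟩

/-- With a outside P in a larger maximal ideal and C ⊆ P invertible and radical, put K = C : a, and
localize at a prime Q minimal over (a) + K. There all (aⁱ) + K with i > 0 are powers of m. Comparing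
exponents forces K ⊆ ((a) + K)², which is impossible. -/
theorem IsSPRing.isMaximal_of_isPrime (h : IsSPRing R) {P : Ideal R} (hP : P.IsPrime)
    (hPr : IsRegularIdeal P) : P.IsMaximal := by
  obtain ⟨Q₀, hQ₀, hPQ₀⟩ := P.exists_le_maximal hP.ne_top
  by_contra hmax
  obtain ⟨a, haQ, haP⟩ : ∃ a ∈ Q₀, a ∉ P := by
    by_contra! hcon
    exact hmax (le_antisymm hPQ₀ hcon ▸ hQ₀)
  obtain ⟨x, hxP, hx0⟩ := hPr
  obtain ⟨C, hCP, hCinv, hCrad⟩ := exists_isRadical_isInvertibleIdeal_le hP hxP hx0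
    (h _ (isRegularIdeal_span_singleton hx0))
  let K : Ideal R := Submodule.comap (LinearMap.mulLeft R a) C
  have hKmem : ∀ y, y ∈ K ↔ a * y ∈ C := fun y => Iff.rfl
  have hCK : C ≤ K := fun y hy => (hKmem y).2 (C.mul_mem_left a hy)
  have hKP : K ≤ P := fun y hy => (hP.mem_or_mem (hCP ((hKmem y).1 hy))).resolve_left haP
  have hKr : IsRegularIdeal K := hCinv.isRegularIdeal.mono hCK
  have hLQ₀ : Ideal.span {a} ⊔ K ≤ Q₀ :=
    sup_le ((Ideal.span_singleton_le_iff_mem _).2 haQ) (hKP.trans hPQ₀)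
  have := hQ₀.isPrime
  obtain ⟨Q, hQ, -⟩ := Ideal.exists_minimalPrimes_le hLQ₀
  have : Q.IsPrime := hQ.1.1
  have haQ' : a ∈ Q := hQ.1.2 (Ideal.mem_sup_left (Ideal.mem_span_singleton_self a))
  have hKQ : K ≤ Q := le_sup_right.trans hQ.1.2
  set S := Localization.AtPrime Q
  set f := algebraMap R S
  set m := IsLocalRing.maximalIdeal S
  -- the localization of `C`
  obtain ⟨C', d, hd, hCd⟩ := isInvertibleIdeal_iff.1 hCinv
  have hfd : f d ∈ S⁰ := IsLocalization.nonZeroDivisors_le_comap Q.primeCompl S hd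
  obtain ⟨c, hc, hCc⟩ := exists_eq_span_singleton_of_mul_eq_span_singleton
    (I := C.map f) (J := C'.map f) hfd (by rw [← Ideal.map_mul, hCd, Ideal.map_span,
      Set.image_singleton])
  have hKc : ∀ y, y ∈ K.map f ↔ f a * y ∈ Ideal.span {c} := by
    intro y
    obtain ⟨y, s, rfl⟩ := IsLocalization.exists_mk'_eq Q.primeCompl y
    rw [← hCc, IsLocalization.mul_mk'_eq_mk'_of_mul,
      IsLocalization.mk'_mem_map_algebraMap_iff Q.primeCompl,
      IsLocalization.mk'_mem_map_algebraMap_iff Q.primeCompl]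
    simp only [hKmem, mul_left_comm a]
  have hac : f a ∉ Ideal.span {c} := by
    rw [← hCc, IsLocalization.algebraMap_mem_map_algebraMap_iff Q.primeCompl]
    rintro ⟨s, hs, hsa⟩
    exact hs (hKQ ((hKmem s).2 (mul_comm s a ▸ hsa)))
  have hrad : (Ideal.span {c}).IsRadical := by
    rw [← hCc, ← Ideal.radical_eq_iff, ← IsLocalization.map_radical Q.primeCompl, hCrad.radical]
  have hpow : ∀ i, f a ^ i ∉ K.map f := by
    intro i hi
    rw [hKc, ← pow_succ'] at hi
    exact hac (hrad ⟨i + 1, hi⟩)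
  have hI : ∀ i, i ≠ 0 → ∃ n, (Ideal.span {f a ^ i} ⊔ K.map f) = m ^ n := by
    intro i hi
    obtain ⟨n, hn⟩ := map_eq_maximalIdeal_pow_of_isProductOfRadicalIdeals
      (I := Ideal.span {a ^ i} ⊔ K) hQ (sup_le
        ((Ideal.span_singleton_le_iff_mem _).2 ⟨i, Ideal.mem_sup_left
          (Ideal.mem_span_singleton_self _)⟩) (le_sup_right.trans Ideal.le_radical))
      (h _ (hKr.mono le_sup_right))
    refine ⟨n, ?_⟩
    rw [← hn, Ideal.map_sup, Ideal.map_span, Set.image_singleton, map_pow]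
  obtain ⟨r, hr⟩ := hI 1 one_ne_zero
  have ham : f a ∈ m := (IsLocalization.AtPrime.to_map_mem_maximal_iff S Q a).2 haQ'
  have hr0 : r ≠ 0 := by
    rintro rfl
    have h1 : Ideal.span {f a ^ 1} ⊔ K.map f ≤ m := by
      refine sup_le ?_ ?_
      · rwa [pow_one, Ideal.span_singleton_le_iff_mem]
      · rw [Ideal.map_le_iff_le_comap]
        exact fun y hy => (IsLocalization.AtPrime.to_map_mem_maximal_iff S Q y).2 (hKQ hy)
    rw [hr, pow_zero, Ideal.one_eq_top] at h1
    exact (IsLocalRing.maximalIdeal.isMaximal S).ne_top (top_le_iff.1 h1)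
  obtain ⟨n, hn⟩ := hI (r * 2) (by omega)
  -- If n < 2r, then aⁿ lies in (a²ʳ) + K, so aⁿ times a unit is in K; but no power of a is in K.
  have hrn : r * 2 ≤ n := by
    by_contra! hlt
    have h1 : f a ^ n ∈ Ideal.span {f a ^ (r * 2)} ⊔ K.map f := hn ▸ Ideal.pow_mem_pow ham n
    obtain ⟨p, hp, q, hq, hpq⟩ := Submodule.mem_sup.1 h1
    obtain ⟨t, rfl⟩ := Ideal.mem_span_singleton.1 hp
    have h2 : f a ^ (r * 2) = f a ^ n * f a ^ (r * 2 - n) := by rw [← pow_add]; congr 1; omega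
    have h3 : f a ^ (r * 2 - n) * t ∈ m :=
      Ideal.mul_mem_right _ _ (Ideal.pow_mem_of_mem _ ham _ (by omega))
    refine hpow n ((Ideal.mul_unit_mem_iff_mem _ (IsLocalRing.isUnit_one_sub h3)).1 ?_)
    convert! hq using 1
    rw [h2] at hpq
    linear_combination -hpq
  refine false_of_colon_le_sup_sq hc hrad ham hac hKc ?_
  rw [pow_one] at hr
  rw [hr, ← pow_mul]
  exact le_sup_right.trans (hn.le.trans (Ideal.pow_le_pow_right hrn))

end Dimension

/-! ### Exponents at maximal regular ideals, and the Prüfer property. -/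

section Valuation

variable {R : Type*} [CommRing R]

/-- Every regular prime ideal is maximal and contains an invertible radical ideal. -/
def HasInvertibleRadicalIdeals (R : Type*) [CommRing R] : Prop :=
  ∀ P : Ideal R, P.IsPrime → IsRegularIdeal P →
    P.IsMaximal ∧ ∃ J : Ideal R, J ≤ P ∧ IsInvertibleIdeal J ∧ J.IsRadical

/-- If a lies in Q but not in P, then A = rad(a, x) divides rad(x), with a cofactor C inside P. The
invertible ideal D = rad(A + C) divides both factors, so rad(x) = D²A'C'. Radicality removes one D,
forcing D = R, although D ⊆ Q. -/
theorem hasInvertibleRadicalIdeals_of_isInvertibleIdeal_radical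
    (h : ∀ I : Ideal R, I.FG → IsRegularIdeal I → IsInvertibleIdeal I.radical) :
    HasInvertibleRadicalIdeals R := by
  rintro P hP ⟨x, hxP, hx⟩
  have hxr := isRegularIdeal_span_singleton hx
  have hB := h (Ideal.span {x}) (Submodule.fg_span_singleton x) hxr
  have hBP : (Ideal.span {x}).radical ≤ P :=
    hP.radical_le_iff.2 ((Ideal.span_singleton_le_iff_mem _).2 hxP)
  refine ⟨?_, _, hBP, hB, Ideal.radical_isRadical _⟩
  obtain ⟨Q, hQ, hPQ⟩ := P.exists_le_maximal hP.ne_top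
  by_contra hmax
  obtain ⟨a, haQ, haP⟩ : ∃ a ∈ Q, a ∉ P := by
    by_contra! hcon
    exact hmax (le_antisymm hPQ hcon ▸ hQ)
  have hA := h (Ideal.span {a} ⊔ Ideal.span {x})
    ((Submodule.fg_span_singleton a).sup (Submodule.fg_span_singleton x)) (hxr.mono le_sup_right)
  set A := (Ideal.span {a} ⊔ Ideal.span {x}).radical with hAdef
  obtain ⟨C, hC⟩ := hA.dvd (Ideal.radical_mono le_sup_right : (Ideal.span {x}).radical ≤ A)
  have haA : a ∈ A := Ideal.le_radical (Ideal.mem_sup_left (Ideal.mem_span_singleton_self a))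
  have hCP : C ≤ P :=
    (hP.mul_le.1 (hC ▸ hBP)).resolve_left fun hAP => haP (hAP haA)
  have hAQ : A ≤ Q := hQ.isPrime.radical_le_iff.2
    (sup_le ((Ideal.span_singleton_le_iff_mem _).2 haQ)
      ((Ideal.span_singleton_le_iff_mem _).2 (hPQ hxP)))
  have hCi : IsInvertibleIdeal C := (hC ▸ hB).of_mul_right
  have hD := h (A ⊔ C) (Submodule.FG.sup hA.fg hCi.fg) (hA.isRegularIdeal.mono le_sup_left)
  set D := (A ⊔ C).radical
  obtain ⟨A', hA'⟩ := hD.dvd (le_sup_left.trans Ideal.le_radical : A ≤ D)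
  obtain ⟨C', hC'⟩ := hD.dvd (le_sup_right.trans Ideal.le_radical : C ≤ D)
  have hA'i : IsInvertibleIdeal A' := (hA' ▸ hA).of_mul_right
  have hC'i : IsInvertibleIdeal C' := (hC' ▸ hCi).of_mul_right
  have h1 : D * (A' * C') ≤ D * (D * (A' * C')) := by
    have h2 : D * (D * (A' * C')) = (Ideal.span {x}).radical := by rw [hC, hA', hC']; ring
    have hrad := Ideal.radical_isRadical (Ideal.span {x})
    rw [← h2] at hrad
    refine fun y hy => hrad ⟨2, ?_⟩
    have : (D * (A' * C')) * (D * (A' * C')) ≤ D * (D * (A' * C')) := by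
      calc D * (A' * C') * (D * (A' * C')) = A' * C' * (D * (D * (A' * C'))) := by ring
        _ ≤ _ := Ideal.mul_le_right
    rw [sq]
    exact this (Ideal.mul_mem_mul hy hy)
  have h2 : (A' * C') * ⊤ ≤ (A' * C') * D := by
    rw [Ideal.mul_top, mul_comm _ D]
    exact hD.le_of_mul_le_mul h1
  have h3 : D ≤ Q := hQ.isPrime.radical_le_iff.2 (sup_le hAQ (hCP.trans hPQ))
  exact hQ.ne_top (top_le_iff.1 (((hA'i.mul hC'i).le_of_mul_le_mul h2).trans h3))

variable {I J : Ideal R}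

theorem HasInvertibleRadicalIdeals.mem_minimalPrimes (h : HasInvertibleRadicalIdeals R)
    {M : Ideal R} (hM : M.IsMaximal) (hI : IsRegularIdeal I) (hIM : I ≤ M) :
    M ∈ I.minimalPrimes :=
  ⟨⟨hM.isPrime, hIM⟩, fun p hp hpM =>
    ((h p hp.1 (hI.mono hp.2)).1.eq_of_le hM.ne_top hpM).ge⟩

instance MaxReg.isPrime (M : MaxReg R) : M.1.IsPrime := M.2.1.isPrime

/-- The localization of `R` at a maximal regular ideal. -/
abbrev MaxReg.Loc (M : MaxReg R) : Type _ := Localization.AtPrime M.1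

/-- The extension of an ideal of `R` to the localization at a maximal regular ideal. -/
abbrev MaxReg.ext (M : MaxReg R) (I : Ideal R) : Ideal M.Loc := I.map (algebraMap R M.Loc)

theorem MaxReg.ext_eq_top {M : MaxReg R} (hI : ¬ I ≤ M.1) : M.ext I = ⊤ := by
  obtain ⟨x, hxI, hxM⟩ := SetLike.not_le_iff_exists.1 hI
  exact Ideal.eq_top_of_isUnit_mem _ (Ideal.mem_map_of_mem _ hxI)
    ((IsLocalization.AtPrime.isUnit_to_map_iff _ M.1 x).2 hxM)

theorem MaxReg.ext_le_maximalIdeal {M : MaxReg R} (hI : I ≤ M.1) :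
    M.ext I ≤ IsLocalRing.maximalIdeal M.Loc := by
  rw [MaxReg.ext, Ideal.map_le_iff_le_comap]
  exact fun y hy => (IsLocalization.AtPrime.to_map_mem_maximal_iff M.Loc M.1 y).2 (hI hy)

theorem HasInvertibleRadicalIdeals.radical_ext (h : HasInvertibleRadicalIdeals R) {M : MaxReg R}
    (hI : IsRegularIdeal I) (hIM : I ≤ M.1) :
    (M.ext I).radical = IsLocalRing.maximalIdeal M.Loc := by
  rw [← IsLocalization.AtPrime.map_eq_maximalIdeal M.1]
  exact IsLocalization.AtPrime.radical_map_of_mem_minimalPrimes _ M.1 I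
    (h.mem_minimalPrimes M.2.1 hI hIM)

theorem HasInvertibleRadicalIdeals.exists_maximalIdeal_eq (h : HasInvertibleRadicalIdeals R)
    (M : MaxReg R) : ∃ c ∈ (M.Loc)⁰, IsLocalRing.maximalIdeal M.Loc = Ideal.span {c} := by
  obtain ⟨J, hJM, hJ, hJr⟩ := (h M.1 M.2.1.isPrime M.2.2).2
  rw [← h.radical_ext hJ.isRegularIdeal hJM, ← IsLocalization.map_radical M.1.primeCompl,
    hJr.radical]
  obtain ⟨C', d, hd, hCd⟩ := isInvertibleIdeal_iff.1 hJ
  exact exists_eq_span_singleton_of_mul_eq_span_singleton (J := C'.map (algebraMap R M.Loc))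
    (IsLocalization.nonZeroDivisors_le_comap M.1.primeCompl M.Loc hd)
    (by rw [← Ideal.map_mul, hCd, Ideal.map_span, Set.image_singleton])

/-- The exponent is the least n with cⁿ in the extension, where c generates the maximal ideal. An
element c^k u of the extension with k < n cannot have u a unit. -/
theorem HasInvertibleRadicalIdeals.exists_ext_eq (h : HasInvertibleRadicalIdeals R)
    (M : MaxReg R) (hI : IsRegularIdeal I) :
    ∃ n, M.ext I = IsLocalRing.maximalIdeal M.Loc ^ n := by
  by_cases hIM : I ≤ M.1
  · obtain ⟨c, -, hc⟩ := h.exists_maximalIdeal_eq M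
    have hex : ∃ n, c ^ n ∈ M.ext I := by
      have : c ∈ (M.ext I).radical := by
        rw [h.radical_ext hI hIM, hc]; exact Ideal.mem_span_singleton_self c
      exact this
    classical
    refine ⟨Nat.find hex, le_antisymm ?_ ?_⟩
    · have key : ∀ k ≤ Nat.find hex, M.ext I ≤ IsLocalRing.maximalIdeal M.Loc ^ k := by
        intro k hk
        induction k with
        | zero => simp [Ideal.one_eq_top]
        | succ k ih =>
          intro y hy
          have hyk := ih (by omega) hy
          rw [hc, Ideal.span_singleton_pow, Ideal.mem_span_singleton] at hyk
          obtain ⟨u, rfl⟩ := hyk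
          have hu : u ∈ IsLocalRing.maximalIdeal M.Loc := by
            rw [IsLocalRing.mem_maximalIdeal, mem_nonunits_iff]
            exact fun hu => Nat.find_min hex (show k < Nat.find hex by omega)
              ((Ideal.mul_unit_mem_iff_mem _ hu).1 hy)
          rw [pow_succ]
          refine Ideal.mul_mem_mul (Ideal.pow_mem_pow ?_ k) hu
          rw [hc]; exact Ideal.mem_span_singleton_self c
      exact key _ le_rfl
    · rw [hc, Ideal.span_singleton_pow, Ideal.span_singleton_le_iff_mem]
      exact Nat.find_spec hex
  · exact ⟨0, by rw [MaxReg.ext_eq_top hIM, pow_zero, Ideal.one_eq_top]⟩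

theorem HasInvertibleRadicalIdeals.le_of_pow_le_pow (h : HasInvertibleRadicalIdeals R)
    (M : MaxReg R) {k l : ℕ}
    (hkl : IsLocalRing.maximalIdeal M.Loc ^ k ≤ IsLocalRing.maximalIdeal M.Loc ^ l) : l ≤ k := by
  obtain ⟨c, hc0, hc⟩ := h.exists_maximalIdeal_eq M
  by_contra! hlt
  rw [hc, Ideal.span_singleton_pow, Ideal.span_singleton_pow, Ideal.span_singleton_le_iff_mem,
    Ideal.mem_span_singleton] at hkl
  obtain ⟨r, hr⟩ := hkl
  have h1 : c ^ k * 1 = c ^ k * (c ^ (l - k) * r) := by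
    rw [mul_one, ← mul_assoc, ← pow_add, Nat.add_sub_cancel' hlt.le]; exact hr
  have h2 := (mul_cancel_left_mem_nonZeroDivisors (pow_mem hc0 k)).1 h1
  have h3 : c ∈ IsLocalRing.maximalIdeal M.Loc := by
    rw [hc]; exact Ideal.mem_span_singleton_self c
  have h4 : (1 : M.Loc) ∈ IsLocalRing.maximalIdeal M.Loc := by
    rw [h2]; exact Ideal.mul_mem_right _ _ (Ideal.pow_mem_of_mem _ h3 _ (by omega))
  exact (IsLocalRing.maximalIdeal.isMaximal _).ne_top ((Ideal.eq_top_iff_one _).2 h4)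

open Classical in
/-- The exponent `n` with `I R_M = (M R_M) ^ n`, and `0` if there is none. -/
noncomputable def MaxReg.val (M : MaxReg R) (I : Ideal R) : ℕ :=
  if hn : ∃ n, M.ext I = IsLocalRing.maximalIdeal M.Loc ^ n then hn.choose else 0

namespace HasInvertibleRadicalIdeals

theorem ext_eq (h : HasInvertibleRadicalIdeals R) (M : MaxReg R) (hI : IsRegularIdeal I) :
    M.ext I = IsLocalRing.maximalIdeal M.Loc ^ M.val I := by
  have := h.exists_ext_eq M hI
  rw [MaxReg.val, dif_pos this]
  exact this.choose_spec

theorem ext_le_ext_iff (h : HasInvertibleRadicalIdeals R) (M : MaxReg R) (hI : IsRegularIdeal I)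
    (hJ : IsRegularIdeal J) : M.ext I ≤ M.ext J ↔ M.val J ≤ M.val I := by
  rw [h.ext_eq M hI, h.ext_eq M hJ]
  exact ⟨h.le_of_pow_le_pow M, Ideal.pow_le_pow_right⟩

theorem val_mono (h : HasInvertibleRadicalIdeals R) (M : MaxReg R) (hI : IsRegularIdeal I)
    (hIJ : I ≤ J) : M.val J ≤ M.val I :=
  (h.ext_le_ext_iff M hI (hI.mono hIJ)).1 (Ideal.map_mono hIJ)

theorem val_eq (h : HasInvertibleRadicalIdeals R) (M : MaxReg R) (hI : IsRegularIdeal I) {n : ℕ}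
    (hn : M.ext I = IsLocalRing.maximalIdeal M.Loc ^ n) : M.val I = n := by
  rw [h.ext_eq M hI] at hn
  exact le_antisymm (h.le_of_pow_le_pow M hn.ge) (h.le_of_pow_le_pow M hn.le)

theorem val_mul (h : HasInvertibleRadicalIdeals R) (M : MaxReg R) (hI : IsRegularIdeal I)
    (hJ : IsRegularIdeal J) : M.val (I * J) = M.val I + M.val J := by
  apply h.val_eq M (hI.mul hJ)
  rw [pow_add, ← h.ext_eq M hI, ← h.ext_eq M hJ]
  exact Ideal.map_mul _ _ _

theorem val_top (h : HasInvertibleRadicalIdeals R) (M : MaxReg R) : M.val (⊤ : Ideal R) = 0 := by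
  apply h.val_eq M isRegularIdeal_top
  rw [pow_zero, Ideal.one_eq_top]
  exact Ideal.map_top _

theorem val_pow (h : HasInvertibleRadicalIdeals R) (M : MaxReg R) (hI : IsRegularIdeal I) (n : ℕ) :
    M.val (I ^ n) = n * M.val I := by
  induction n with
  | zero => rw [pow_zero, Ideal.one_eq_top, h.val_top, zero_mul]
  | succ n ih => rw [pow_succ, h.val_mul M (hI.pow n) hI, ih, add_mul, one_mul]

theorem val_sup (h : HasInvertibleRadicalIdeals R) (M : MaxReg R) (hI : IsRegularIdeal I)
    (hJ : IsRegularIdeal J) : M.val (I ⊔ J) = min (M.val I) (M.val J) := by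
  apply h.val_eq M (hI.mono le_sup_left)
  have : M.ext (I ⊔ J) = M.ext I ⊔ M.ext J := Ideal.map_sup _ _ _
  rw [this, h.ext_eq M hI, h.ext_eq M hJ]
  rcases le_total (M.val I) (M.val J) with hle | hle
  · rw [min_eq_left hle, sup_eq_left.2 (Ideal.pow_le_pow_right hle)]
  · rw [min_eq_right hle, sup_eq_right.2 (Ideal.pow_le_pow_right hle)]

theorem le_iff (h : HasInvertibleRadicalIdeals R) (hI : IsRegularIdeal I)
    (hJ : IsRegularIdeal J) : I ≤ J ↔ ∀ M : MaxReg R, M.val J ≤ M.val I := by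
  refine ⟨fun hIJ M => h.val_mono M hI hIJ, fun hv => ?_⟩
  refine Ideal.le_of_localization_maximal fun P hP => ?_
  by_cases hPr : IsRegularIdeal P
  · exact (h.ext_le_ext_iff ⟨P, hP, hPr⟩ hI hJ).2 (hv ⟨P, hP, hPr⟩)
  · obtain ⟨x, hx, hx0⟩ := hJ
    have : J.map (algebraMap R (Localization.AtPrime P)) = ⊤ :=
      Ideal.eq_top_of_isUnit_mem _ (Ideal.mem_map_of_mem _ hx)
        ((IsLocalization.AtPrime.isUnit_to_map_iff _ P x).2 fun hxP => hPr ⟨x, hxP, hx0⟩)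
    rw [this]
    exact le_top

theorem eq_of_val_eq (h : HasInvertibleRadicalIdeals R) (hI : IsRegularIdeal I)
    (hJ : IsRegularIdeal J) (hv : ∀ M : MaxReg R, M.val I = M.val J) : I = J :=
  le_antisymm ((h.le_iff hI hJ).2 fun M => (hv M).ge) ((h.le_iff hJ hI).2 fun M => (hv M).le)

theorem val_eq_zero_iff (h : HasInvertibleRadicalIdeals R) (M : MaxReg R) (hI : IsRegularIdeal I) :
    M.val I = 0 ↔ ¬ I ≤ M.1 := by
  refine ⟨fun h0 hle => ?_, fun hle => h.val_eq M hI ?_⟩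
  · have h1 := MaxReg.ext_le_maximalIdeal hle
    rw [h.ext_eq M hI, h0, pow_zero, Ideal.one_eq_top, top_le_iff] at h1
    exact (IsLocalRing.maximalIdeal.isMaximal _).ne_top h1
  · rw [MaxReg.ext_eq_top hle, pow_zero, Ideal.one_eq_top]

theorem one_le_val_iff (h : HasInvertibleRadicalIdeals R) (M : MaxReg R) (hI : IsRegularIdeal I) :
    1 ≤ M.val I ↔ I ≤ M.1 := by
  rw [Nat.one_le_iff_ne_zero, Ne, h.val_eq_zero_iff M hI, not_not]

theorem isRadical_iff (h : HasInvertibleRadicalIdeals R) (hI : IsRegularIdeal I) :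
    I.IsRadical ↔ ∀ M : MaxReg R, M.val I ≤ 1 := by
  constructor
  · intro hr M
    by_cases hIM : I ≤ M.1
    · refine (h.val_eq M hI (n := 1) ?_).le
      rw [pow_one, ← h.radical_ext hI hIM, ← IsLocalization.map_radical M.1.primeCompl, hr.radical]
    · rw [(h.val_eq_zero_iff M hI).2 hIM]
      exact zero_le_one
  · intro hv
    refine isRadical_of_sq_le fun x hx => ?_
    -- The element x may be a zerodivisor, so exponents are compared for I + (x), whose square lies
    -- in I.
    have hr : IsRegularIdeal (I ⊔ Ideal.span {x}) := hI.mono le_sup_left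
    have h1 : (I ⊔ Ideal.span {x}) * (I ⊔ Ideal.span {x}) ≤ I := by
      rw [Ideal.sup_mul, Ideal.mul_sup, Ideal.mul_sup, Ideal.span_singleton_mul_span_singleton,
        ← sq x]
      exact sup_le (sup_le Ideal.mul_le_left Ideal.mul_le_left)
        (sup_le Ideal.mul_le_right ((Ideal.span_singleton_le_iff_mem _).2 hx))
    have h2 : I ⊔ Ideal.span {x} ≤ I := by
      rw [h.le_iff hr hI]
      intro M
      have h3 := h.val_mono M (hr.mul hr) h1
      rw [h.val_mul M hr hr] at h3
      have := hv M
      omega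
    exact h2 (Ideal.mem_sup_right (Ideal.mem_span_singleton_self x))

theorem val_radical (h : HasInvertibleRadicalIdeals R) (M : MaxReg R) (hI : IsRegularIdeal I) :
    M.val I.radical = min (M.val I) 1 := by
  have hr : IsRegularIdeal I.radical := hI.mono Ideal.le_radical
  have h1 := (h.isRadical_iff hr).1 (Ideal.radical_isRadical I) M
  have h2 := h.one_le_val_iff M hr
  have h3 := h.one_le_val_iff M hI
  rw [M.isPrime.radical_le_iff, ← h3] at h2
  omega

end HasInvertibleRadicalIdeals

theorem exists_forall_mul_mem_of_map_le {P : Ideal R} [P.IsPrime] (hI : I.FG)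
    (hIJ : I.map (algebraMap R (Localization.AtPrime P)) ≤
      J.map (algebraMap R (Localization.AtPrime P))) : ∃ s ∉ P, ∀ y ∈ I, s * y ∈ J := by
  induction I, hI using Submodule.fg_induction with
  | singleton x =>
    obtain ⟨s, hs, hsx⟩ := (IsLocalization.algebraMap_mem_map_algebraMap_iff P.primeCompl _ J x).1
      (hIJ (Ideal.mem_map_of_mem _ (Ideal.mem_span_singleton_self x)))
    refine ⟨s, hs, fun y hy => ?_⟩
    obtain ⟨r, rfl⟩ := Ideal.mem_span_singleton.1 hy
    rw [← mul_assoc]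
    exact J.mul_mem_right r hsx
  | sup A B _ _ hA hB =>
    obtain ⟨s, hs, hsA⟩ := hA ((Ideal.map_mono le_sup_left).trans hIJ)
    obtain ⟨t, ht, htB⟩ := hB ((Ideal.map_mono le_sup_right).trans hIJ)
    refine ⟨s * t, P.primeCompl.mul_mem hs ht, fun y hy => ?_⟩
    obtain ⟨a, ha, b, hb, rfl⟩ := Submodule.mem_sup.1 hy
    have : s * t * (a + b) = t * (s * a) + s * (t * b) := by ring
    rw [this]
    exact add_mem (J.mul_mem_left _ (hsA a ha)) (J.mul_mem_left _ (htB b hb))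

/-- If `I R_M` is a power of the maximal ideal, it is generated by the image of an element of `I`. -/
theorem HasInvertibleRadicalIdeals.exists_mem_ext_eq_ext_span (h : HasInvertibleRadicalIdeals R)
    (M : MaxReg R) (hI : IsRegularIdeal I) : ∃ x ∈ I, M.ext I = M.ext (Ideal.span {x}) := by
  obtain ⟨c, hc0, hc⟩ := h.exists_maximalIdeal_eq M
  have hex : ∃ x ∈ I, algebraMap R M.Loc x ∉ IsLocalRing.maximalIdeal M.Loc ^ (M.val I + 1) := by
    by_contra! hcon
    have : M.ext I ≤ IsLocalRing.maximalIdeal M.Loc ^ (M.val I + 1) := by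
      rw [MaxReg.ext, Ideal.map_le_iff_le_comap]
      exact hcon
    rw [h.ext_eq M hI] at this
    have := h.le_of_pow_le_pow M this
    omega
  obtain ⟨x, hxI, hx⟩ := hex
  refine ⟨x, hxI, le_antisymm ?_ (Ideal.map_mono ((Ideal.span_singleton_le_iff_mem _).2 hxI))⟩
  have hxe : algebraMap R M.Loc x ∈ M.ext I := Ideal.mem_map_of_mem _ hxI
  rw [h.ext_eq M hI, hc, Ideal.span_singleton_pow] at hxe ⊢
  obtain ⟨u, hu⟩ := Ideal.mem_span_singleton.1 hxe
  have huu : IsUnit u := by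
    by_contra hcon
    have h1 : u ∈ IsLocalRing.maximalIdeal M.Loc :=
      (IsLocalRing.mem_maximalIdeal u).2 (mem_nonunits_iff.2 hcon)
    apply hx
    rw [hu, pow_succ]
    refine Ideal.mul_mem_mul (Ideal.pow_mem_pow ?_ _) h1
    rw [hc]; exact Ideal.mem_span_singleton_self c
  rw [Ideal.span_singleton_le_iff_mem, ← Ideal.mul_unit_mem_iff_mem _ huu, ← hu]
  exact Ideal.mem_map_of_mem _ (Ideal.mem_span_singleton_self x)

/-- With K = (d) : I for a regular d in I, the equality IK = (d) is checked locally, where I is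
principal. -/
theorem HasInvertibleRadicalIdeals.isPruferRing (h : HasInvertibleRadicalIdeals R) :
    IsPruferRing R := by
  rintro I hfg ⟨d, hdI, hd⟩
  let K : Ideal R :=
    { carrier := {r | ∀ y ∈ I, r * y ∈ Ideal.span {d}}
      add_mem' := fun ha hb y hy => by rw [add_mul]; exact add_mem (ha y hy) (hb y hy)
      zero_mem' := fun y _ => by rw [zero_mul]; exact zero_mem _
      smul_mem' := fun c x hx y hy => by
        rw [smul_eq_mul, mul_assoc]; exact Ideal.mul_mem_left _ _ (hx y hy) }
  have hdK : d ∈ K := fun y _ => Ideal.mul_mem_right _ _ (Ideal.mem_span_singleton_self d)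
  refine isInvertibleIdeal_iff.2 ⟨K, d, hd, le_antisymm ?_ ?_⟩
  · rw [Ideal.mul_le]
    intro y hy r hr
    rw [mul_comm]
    exact hr y hy
  rw [Ideal.span_singleton_le_iff_mem]
  refine Ideal.mem_of_localization_maximal fun P hP => ?_
  rw [IsLocalization.algebraMap_mem_map_algebraMap_iff P.primeCompl]
  by_cases hPr : IsRegularIdeal P
  · obtain ⟨x, hxI, hx⟩ := h.exists_mem_ext_eq_ext_span ⟨P, hP, hPr⟩ ⟨d, hdI, hd⟩
    obtain ⟨s, hs, hsI⟩ := exists_forall_mul_mem_of_map_le hfg hx.le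
    obtain ⟨r, hr⟩ := Ideal.mem_span_singleton.1 (hsI d hdI)
    refine ⟨s * s, P.primeCompl.mul_mem hs hs, ?_⟩
    have hrK : r * s ∈ K := by
      intro y hy
      obtain ⟨e, he⟩ := Ideal.mem_span_singleton.1 (hsI y hy)
      refine Ideal.mem_span_singleton.2 ⟨s * e, ?_⟩
      calc r * s * y = r * (s * y) := by ring
        _ = x * r * e := by rw [he]; ring
        _ = d * (s * e) := by rw [← hr]; ring
    have : s * s * d = x * (r * s) := by
      calc s * s * d = s * (s * d) := by ring
        _ = x * (r * s) := by rw [hr]; ring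
    rw [this]
    exact Ideal.mul_mem_mul hxI hrK
  -- At a nonregular maximal ideal d becomes a unit, and d² lies in IK.
  · exact ⟨d, fun hdP => hPr ⟨d, hdP, hd⟩, Ideal.mul_mem_mul hdI hdK⟩

end Valuation

/-! ### Truncating upper semicontinuous functions. -/

section UpperSemicontinuous

variable {X : Type*} [TopologicalSpace X] {f : X → ℕ}

theorem comp_mem_uscCompactlySupported (hf : f ∈ uscCompactlySupported X) {φ : ℕ → ℕ}
    (hφ : Monotone φ) (h0 : φ 0 = 0) : (fun x => φ (f x)) ∈ uscCompactlySupported X := by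
  refine ⟨fun x y hy => ?_, hf.2.comp_left h0⟩
  filter_upwards [hf.1 x (f x + 1) (Nat.lt_succ_self _)] with x' hx'
  exact (hφ (Nat.lt_succ_iff.1 hx')).trans_lt hy

theorem exists_forall_le_of_mem_uscCompactlySupported (hf : f ∈ uscCompactlySupported X) :
    ∃ N, ∀ x, f x ≤ N := by
  obtain ⟨N, hN⟩ := (hf.1.upperSemicontinuousOn _).bddAbove_of_isCompact (s := tsupport f) hf.2
  refine ⟨N, fun x => ?_⟩
  by_cases hx : x ∈ tsupport f
  · exact hN ⟨x, hx, rfl⟩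
  · rw [image_eq_zero_of_notMem_tsupport hx]
    exact zero_le

/-- Induction on upper semicontinuous compactly supported functions: each is a sum of functions
bounded by one. -/
theorem uscCompactlySupported_induction {p : (X → ℕ) → Prop} (zero : p fun _ => 0)
    (add : ∀ f ∈ uscCompactlySupported X, p (fun x => f x - 1) → p f)
    (hf : f ∈ uscCompactlySupported X) : p f := by
  obtain ⟨N, hN⟩ := exists_forall_le_of_mem_uscCompactlySupported hf
  induction N generalizing f with
  | zero =>
    have : f = fun _ => 0 := funext fun x => Nat.le_zero.1 (hN x)
    rw [this]; exact zero
  | succ N ih =>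
    refine add f hf (ih (comp_mem_uscCompactlySupported hf
      (fun a b hab => Nat.sub_le_sub_right hab 1) rfl) fun x => ?_)
    have := hN x
    omega

theorem min_one_mem_uscCompactlySupported (hf : f ∈ uscCompactlySupported X) :
    (fun x => min (f x) 1) ∈ uscCompactlySupported X :=
  comp_mem_uscCompactlySupported hf (fun _ _ hab => min_le_min_right 1 hab) rfl

theorem sub_one_mem_uscCompactlySupported (hf : f ∈ uscCompactlySupported X) :
    (fun x => f x - 1) ∈ uscCompactlySupported X :=
  comp_mem_uscCompactlySupported hf (fun _ _ hab => Nat.sub_le_sub_right hab 1) rfl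

end UpperSemicontinuous

/-! ### Exponent functions and the inverse topology. -/

section InverseTopology

variable {R : Type*} [CommRing R] {I : Ideal R}

theorem MaxReg.isOpen_setOf_le (hfg : I.FG) (hI : IsRegularIdeal I) :
    IsOpen {M : MaxReg R | I ≤ M.1} :=
  TopologicalSpace.isOpen_generateFrom_of_mem ⟨I, hfg, hI, rfl⟩

theorem MaxReg.exists_setOf_le_subset {U : Set (MaxReg R)} (hU : IsOpen U) {N : MaxReg R}
    (hN : N ∈ U) : ∃ I : Ideal R, I.FG ∧ IsRegularIdeal I ∧ I ≤ N.1 ∧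
      ∀ M : MaxReg R, I ≤ M.1 → M ∈ U := by
  induction hU with
  | basic s hs =>
    obtain ⟨I, hfg, hI, rfl⟩ := hs
    exact ⟨I, hfg, hI, hN, fun M hM => hM⟩
  | univ =>
    obtain ⟨x, hx, hx0⟩ := N.2.2
    exact ⟨Ideal.span {x}, Submodule.fg_span_singleton x, isRegularIdeal_span_singleton hx0,
      (Ideal.span_singleton_le_iff_mem _).2 hx, fun _ _ => trivial⟩
  | inter s t _ _ hs ht =>
    obtain ⟨I, hIfg, hI, hIN, hIs⟩ := hs hN.1
    obtain ⟨J, hJfg, hJ, hJN, hJt⟩ := ht hN.2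
    exact ⟨I ⊔ J, Submodule.FG.sup hIfg hJfg, hI.mono le_sup_left, sup_le hIN hJN,
      fun M hM => ⟨hIs M (le_sup_left.trans hM), hJt M (le_sup_right.trans hM)⟩⟩
  | sUnion S _ hS =>
    obtain ⟨s, hsS, hNs⟩ := hN
    obtain ⟨I, hfg, hI, hIN, hIs⟩ := hS s hsS hNs
    exact ⟨I, hfg, hI, hIN, fun M hM => ⟨s, hsS, hIs M hM⟩⟩

/-- The limit of an ultrafilter is the ideal of those a lying in almost all M. It is prime and
contains I, hence is maximal by hypothesis. Basic sets need only finitely many generators. -/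
theorem MaxReg.isCompact_setOf_le
    (hmax : ∀ P : Ideal R, P.IsPrime → IsRegularIdeal P → P.IsMaximal) (hI : IsRegularIdeal I) :
    IsCompact {M : MaxReg R | I ≤ M.1} := by
  rw [isCompact_iff_ultrafilter_le_nhds']
  intro u hu
  let Q : Ideal R :=
    { carrier := {a | {M : MaxReg R | a ∈ M.1} ∈ u}
      add_mem' := fun ha hb => Filter.mem_of_superset (Filter.inter_mem ha hb)
        fun M hM => M.1.add_mem hM.1 hM.2
      zero_mem' := Filter.mem_of_superset Filter.univ_mem fun M _ => M.1.zero_mem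
      smul_mem' := fun c _ hx => Filter.mem_of_superset hx fun M hM => M.1.mul_mem_left c hM }
  have hQmem : ∀ a, a ∈ Q ↔ {M : MaxReg R | a ∈ M.1} ∈ u := fun _ => Iff.rfl
  have hIQ : I ≤ Q := fun a ha => Filter.mem_of_superset hu fun M hM => hM ha
  have hQ : Q.IsPrime := by
    refine Ideal.isPrime_iff.2 ⟨?_, ?_⟩
    · rw [Ideal.ne_top_iff_one, hQmem]
      have : {M : MaxReg R | (1 : R) ∈ M.1} = ∅ :=
        Set.eq_empty_of_forall_notMem fun M hM => M.2.1.ne_top ((Ideal.eq_top_iff_one _).2 hM)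
      rw [this]
      exact Ultrafilter.empty_notMem
    · intro a b hab
      rw [hQmem] at hab
      simp only [hQmem]
      rw [← Ultrafilter.union_mem_iff]
      exact Filter.mem_of_superset hab fun M hM => M.isPrime.mem_or_mem hM
  have hQr := hI.mono hIQ
  obtain ⟨N, hN⟩ : ∃ N : MaxReg R, N.1 = Q := ⟨⟨Q, hmax Q hQ hQr, hQr⟩, rfl⟩
  refine ⟨N, (hIQ.trans hN.ge :), ?_⟩
  refine (TopologicalSpace.nhds_generateFrom (a := N)).symm ▸ le_iInf₂ ?_
  rintro _ ⟨hQs, J, ⟨s, rfl⟩, -, rfl⟩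
  rw [Filter.le_principal_iff]
  refine Filter.mem_of_superset ((Filter.biInter_finset_mem s).2 fun a ha =>
    hN.le (hQs (Ideal.subset_span ha))) fun M hM => ?_
  exact Ideal.span_le.2 fun a ha => Set.mem_iInter₂.1 hM a ha

namespace HasInvertibleRadicalIdeals

/-- Let k be the exponent of I at M. A finitely generated I₀ ⊆ I has exponent at most k at M, and
the quotient F of J^(k+1) by I₀ + J^(k+1) has positive exponent exactly where J has exponent 1 and
I₀ at most k. So V(F) is an open neighbourhood of M on which I has exponent at most k. -/
theorem upperSemicontinuous_val (h : HasInvertibleRadicalIdeals R) (hI : IsRegularIdeal I) :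
    UpperSemicontinuous fun M : MaxReg R => M.val I := by
  intro M y hy
  obtain ⟨J, hJM, hJ, hJr⟩ := (h M.1 M.2.1.isPrime M.2.2).2
  obtain ⟨x, hxI, hx⟩ := h.exists_mem_ext_eq_ext_span M hI
  obtain ⟨d, hdI, hd⟩ := id hI
  have hJreg := hJ.isRegularIdeal
  have hval1 : ∀ N : MaxReg R, N.val J ≤ 1 := (h.isRadical_iff hJreg).1 hJr
  have hJM1 : M.val J = 1 := le_antisymm (hval1 M) ((h.one_le_val_iff M hJreg).2 hJM)
  set I₀ := Ideal.span {x} ⊔ Ideal.span {d}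
  have hI₀ : IsRegularIdeal I₀ := (isRegularIdeal_span_singleton hd).mono le_sup_right
  have hI₀I : I₀ ≤ I := sup_le ((Ideal.span_singleton_le_iff_mem _).2 hxI)
    ((Ideal.span_singleton_le_iff_mem _).2 hdI)
  have hI₀M : M.val I₀ ≤ M.val I :=
    (h.ext_le_ext_iff M hI hI₀).1 (hx.le.trans (Ideal.map_mono le_sup_left))
  have hfg : I₀.FG :=
    Submodule.FG.sup (Submodule.fg_span_singleton x) (Submodule.fg_span_singleton d)
  set k := M.val I
  have hJk := hJ.pow (k + 1)
  have hH : IsInvertibleIdeal (I₀ ⊔ J ^ (k + 1)) :=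
    h.isPruferRing _ (Submodule.FG.sup hfg hJk.fg) (hI₀.mono le_sup_left)
  obtain ⟨F, hF⟩ := hH.dvd (le_sup_right : J ^ (k + 1) ≤ _)
  have hFi : IsInvertibleIdeal F := (hF ▸ hJk).of_mul_right
  have hFval : ∀ N : MaxReg R, (k + 1) * N.val J =
      min (N.val I₀) ((k + 1) * N.val J) + N.val F := by
    intro N
    rw [← h.val_pow N hJreg, ← h.val_sup N hI₀ hJk.isRegularIdeal,
      ← h.val_mul N hH.isRegularIdeal hFi.isRegularIdeal, ← hF]
  refine Filter.mem_of_superset ((MaxReg.isOpen_setOf_le hFi.fg hFi.isRegularIdeal).mem_nhds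
    (x := M) ?_) fun N hN => ?_
  · refine (h.one_le_val_iff M hFi.isRegularIdeal).1 ?_
    have := hFval M
    rw [hJM1] at this
    omega
  · have h1 := (h.one_le_val_iff N hFi.isRegularIdeal).2 hN
    have h2 := hFval N
    have h3 := h.val_mono N hI₀ hI₀I
    have h4 : N.val J = 1 := by
      have := hval1 N
      interval_cases hv : N.val J <;> omega
    rw [h4] at h2
    show N.val I < y
    have : k < y := hy
    omega

theorem val_mem_uscCompactlySupported (h : HasInvertibleRadicalIdeals R) (hI : IsRegularIdeal I) :
    (fun M : MaxReg R => M.val I) ∈ uscCompactlySupported (MaxReg R) := by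
  have husc := h.upperSemicontinuous_val hI
  have heq : {M : MaxReg R | I ≤ M.1} = (fun M : MaxReg R => M.val I) ⁻¹' Set.Ici 1 := by
    ext M
    exact (h.one_le_val_iff M hI).symm
  refine ⟨husc, HasCompactSupport.intro'
    (MaxReg.isCompact_setOf_le (fun P hP hPr => (h P hP hPr).1) hI) ?_ ?_⟩
  · rw [heq]
    exact upperSemicontinuous_iff_isClosed_preimage.1 husc 1
  · exact fun M hM => (h.val_eq_zero_iff M hI).2 hM

theorem exists_isRadical_le_of_isCompact (h : HasInvertibleRadicalIdeals R) {Z : Set (MaxReg R)}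
    (hZ : IsCompact Z) :
    ∃ B : Ideal R, IsInvertibleIdeal B ∧ B.IsRadical ∧ ∀ M ∈ Z, B ≤ M.1 := by
  refine hZ.induction_on (p := fun Z => ∃ B : Ideal R, IsInvertibleIdeal B ∧ B.IsRadical ∧
    ∀ M ∈ Z, B ≤ M.1) ?_ ?_ ?_ ?_
  · exact ⟨⊤, isInvertibleIdeal_top, fun _ _ => trivial, fun M hM => hM.elim⟩
  · rintro s t hst ⟨B, hB, hBr, hBt⟩
    exact ⟨B, hB, hBr, fun M hM => hBt M (hst hM)⟩
  · rintro s t ⟨B, hB, hBr, hBs⟩ ⟨C, hC, hCr, hCt⟩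
    have hBreg := hB.isRegularIdeal
    have hCreg := hC.isRegularIdeal
    have hD := h.isPruferRing _ (Submodule.FG.sup hB.fg hC.fg) (hBreg.mono le_sup_left)
    -- The quotient CB / (B + C) has as exponent the maximum of those of B and C.
    obtain ⟨E, hE⟩ := hD.dvd (Ideal.mul_le_right.trans le_sup_left : C * B ≤ _)
    have hEi : IsInvertibleIdeal E := (hE ▸ hC.mul hB).of_mul_right
    have hEreg := hEi.isRegularIdeal
    have hval : ∀ M : MaxReg R, M.val C + M.val B = min (M.val B) (M.val C) + M.val E := by
      intro M
      rw [← h.val_mul M hCreg hBreg, hE, h.val_mul M hD.isRegularIdeal hEreg,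
        h.val_sup M hBreg hCreg]
    have hB1 := (h.isRadical_iff hBreg).1 hBr
    have hC1 := (h.isRadical_iff hCreg).1 hCr
    have hEB : E ≤ B := (h.le_iff hEreg hBreg).2 fun M => by have := hval M; omega
    have hEC : E ≤ C := (h.le_iff hEreg hCreg).2 fun M => by have := hval M; omega
    refine ⟨E, hEi, (h.isRadical_iff hEreg).2 fun M => ?_, ?_⟩
    · have := hval M
      have := hB1 M
      have := hC1 M
      omega
    · rintro M (hM | hM)
      · exact hEB.trans (hBs M hM)
      · exact hEC.trans (hCt M hM)
  · intro M _
    obtain ⟨J, hJM, hJ, hJr⟩ := (h M.1 M.2.1.isPrime M.2.2).2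
    exact ⟨_, mem_nhdsWithin_of_mem_nhds
      ((MaxReg.isOpen_setOf_le hJ.fg hJ.isRegularIdeal).mem_nhds hJM), J, hJ, hJr,
      fun N hN => hN⟩

/-- By compactness some invertible radical B lies in every M containing I, and then rad I = I + B,
both having exponent min(v(I), 1). -/
theorem isInvertibleIdeal_radical (h : HasInvertibleRadicalIdeals R) (hfg : I.FG)
    (hI : IsRegularIdeal I) : IsInvertibleIdeal I.radical := by
  obtain ⟨B, hB, hBr, hBI⟩ := h.exists_isRadical_le_of_isCompact
    (MaxReg.isCompact_setOf_le (fun P hP hPr => (h P hP hPr).1) hI)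
  have hBreg := hB.isRegularIdeal
  have hIB := h.isPruferRing _ (Submodule.FG.sup hfg hB.fg) (hI.mono le_sup_left)
  suffices hrad : I.radical = I ⊔ B from hrad ▸ hIB
  refine h.eq_of_val_eq (hI.mono Ideal.le_radical) hIB.isRegularIdeal fun M => ?_
  rw [h.val_radical M hI, h.val_sup M hI hBreg]
  have h1 := (h.isRadical_iff hBreg).1 hBr M
  by_cases hIM : I ≤ M.1
  · have := (h.one_le_val_iff M hBreg).2 (hBI M hIM)
    omega
  · have := (h.val_eq_zero_iff M hI).2 hIM
    omega

/-- The ideal is the intersection L of the M with f(M) = 1. These form a compact set, so L is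
regular; they form a closed set, so no other N contains L. -/
theorem exists_val_eq_of_le_one (h : HasInvertibleRadicalIdeals R) {f : MaxReg R → ℕ}
    (hf : f ∈ uscCompactlySupported (MaxReg R)) (hf1 : ∀ M, f M ≤ 1) :
    ∃ I : Ideal R, IsRegularIdeal I ∧ ∀ M : MaxReg R, M.val I = f M := by
  set Z : Set (MaxReg R) := f ⁻¹' Set.Ici 1
  have hZc : IsClosed Z := upperSemicontinuous_iff_isClosed_preimage.1 hf.1 1
  have hZ : IsCompact Z := hf.2.of_isClosed_subset hZc fun M hM =>
    subset_tsupport f (Nat.one_le_iff_ne_zero.1 hM)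
  obtain ⟨B, hB, hBr, hBZ⟩ := h.exists_isRadical_le_of_isCompact hZ
  have hBreg := hB.isRegularIdeal
  have hB1 := (h.isRadical_iff hBreg).1 hBr
  set L : Ideal R := ⨅ M ∈ Z, M.1
  have hBL : B ≤ L := le_iInf₂ hBZ
  have hL := hBreg.mono hBL
  have hLr : L.IsRadical := Ideal.isRadical_iInf _ fun M => Ideal.isRadical_iInf _ fun _ =>
    M.isPrime.isRadical
  have hL1 := (h.isRadical_iff hL).1 hLr
  refine ⟨L, hL, fun N => ?_⟩
  by_cases hN : N ∈ Z
  · have h1 : 1 ≤ f N := hN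
    have := (h.one_le_val_iff N hL).2 (iInf₂_le N hN)
    have := hL1 N
    have := hf1 N
    omega
  have h0 : f N = 0 := by
    have : ¬ 1 ≤ f N := hN
    omega
  rw [h0, h.val_eq_zero_iff N hL]
  by_cases hBN : B ≤ N.1
  -- V(J) separates N from Z. The quotient E of B by J + B has exponent 1 on Z and 0 at N, so E ⊆ L
  -- while E is not in N.
  · obtain ⟨J, hJfg, hJ, hJN, hJZ⟩ := MaxReg.exists_setOf_le_subset hZc.isOpen_compl hN
    have hD := h.isPruferRing _ (Submodule.FG.sup hJfg hB.fg) (hJ.mono le_sup_left)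
    obtain ⟨E, hE⟩ := hD.dvd (le_sup_right : B ≤ J ⊔ B)
    have hEi : IsInvertibleIdeal E := (hE ▸ hB).of_mul_right
    have hEreg := hEi.isRegularIdeal
    have hval : ∀ M : MaxReg R, M.val B = min (M.val J) (M.val B) + M.val E := by
      intro M
      rw [← h.val_sup M hJ hBreg, ← h.val_mul M hD.isRegularIdeal hEreg, ← hE]
    have hEL : E ≤ L := by
      refine le_iInf₂ fun M hM => (h.one_le_val_iff M hEreg).1 ?_
      have h1 := (h.val_eq_zero_iff M hJ).2 fun hle => hJZ M hle hM
      have h2 := (h.one_le_val_iff M hBreg).2 (hBZ M hM)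
      have := hval M
      omega
    refine fun hLN => (h.val_eq_zero_iff N hEreg).1 ?_ (hEL.trans hLN)
    have h1 := (h.one_le_val_iff N hJ).2 hJN
    have h2 := hB1 N
    have := hval N
    omega
  · exact fun hLN => hBN (hBL.trans hLN)

theorem exists_val_eq (h : HasInvertibleRadicalIdeals R) {f : MaxReg R → ℕ}
    (hf : f ∈ uscCompactlySupported (MaxReg R)) :
    ∃ I : Ideal R, IsRegularIdeal I ∧ ∀ M : MaxReg R, M.val I = f M := by
  refine uscCompactlySupported_induction
    (p := fun f => ∃ I : Ideal R, IsRegularIdeal I ∧ ∀ M : MaxReg R, M.val I = f M) ⟨⊤, isRegularIdeal_top, h.val_top⟩ ?_ hf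
  rintro f hf ⟨I, hI, hIf⟩
  obtain ⟨J, hJ, hJf⟩ := h.exists_val_eq_of_le_one (min_one_mem_uscCompactlySupported hf)
    fun M => min_le_right _ _
  refine ⟨I * J, hI.mul hJ, fun M => ?_⟩
  rw [h.val_mul M hI hJ, hIf, hJf]
  exact Nat.sub_add_min_cancel (f M) 1

end HasInvertibleRadicalIdeals

end InverseTopology

/-! ### Chain factorizations. -/

section Factorization

variable {R : Type*} [CommRing R] {I : Ideal R}

/-- A power of the smallest factor J lies in I, and I ⊆ J. Uniqueness follows by cancelling this
factor. -/
theorem IsRadicalChainFactorization.head_eq_radical {J : Ideal R} {l : List (Ideal R)}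
    (hl : IsRadicalChainFactorization I (J :: l)) : J = I.radical := by
  obtain ⟨hchain, hJ, hprod⟩ := hl
  rw [List.prod_cons] at hprod
  refine le_antisymm ?_ ?_
  · have key : ∀ l : List (Ideal R), (∀ K ∈ l, J ≤ K) → J ^ l.length ≤ l.prod := by
      intro l
      induction l with
      | nil => intro _; simp
      | cons K l ih =>
        intro hK
        rw [List.length_cons, List.prod_cons, pow_succ']
        exact Ideal.mul_mono (hK K List.mem_cons_self) (ih fun L hL => hK L (List.mem_cons_of_mem K hL))
    have h1 : J ^ (l.length + 1) ≤ I := by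
      rw [← hprod, pow_succ']
      exact Ideal.mul_mono_right (key l fun K hK => List.rel_of_pairwise_cons hchain hK)
    exact fun x hx => ⟨l.length + 1, h1 (Ideal.pow_mem_pow hx _)⟩
  · rw [(hJ J List.mem_cons_self).1.radical_le_iff, ← hprod]
    exact Ideal.mul_le_left

theorem IsRadicalChainFactorization.isProductOfRadicalIdeals {l : List (Ideal R)}
    (hl : IsRadicalChainFactorization I l) : IsProductOfRadicalIdeals I :=
  ⟨l, fun J hJ => (hl.2.1 J (Multiset.mem_coe.1 hJ)).1, by rw [Multiset.prod_coe, hl.2.2]⟩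

namespace HasInvertibleRadicalIdeals

theorem isRadicalChainFactorization_unique (h : HasInvertibleRadicalIdeals R)
    (hI : IsRegularIdeal I) {l l' : List (Ideal R)} (hl : IsRadicalChainFactorization I l)
    (hl' : IsRadicalChainFactorization I l') : l = l' := by
  induction l generalizing I l' with
  | nil =>
    cases l' with
    | nil => rfl
    | cons J l' =>
      have h1 : J * l'.prod = ⊤ := by
        rw [← List.prod_cons, hl'.2.2, ← hl.2.2, List.prod_nil, Ideal.one_eq_top]
      exact ((hl'.2.1 J List.mem_cons_self).2 (top_le_iff.1 (h1.ge.trans Ideal.mul_le_left))).elim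
  | cons J l ih =>
    cases l' with
    | nil =>
      have h1 : J * l.prod = ⊤ := by
        rw [← List.prod_cons, hl.2.2, ← hl'.2.2, List.prod_nil, Ideal.one_eq_top]
      exact ((hl.2.1 J List.mem_cons_self).2 (top_le_iff.1 (h1.ge.trans Ideal.mul_le_left))).elim
    | cons J' l' =>
      have hJJ : J' = J := hl'.head_eq_radical.trans hl.head_eq_radical.symm
      subst hJJ
      have hp : J' * l.prod = I := by rw [← List.prod_cons, hl.2.2]
      have hp' : J' * l'.prod = I := by rw [← List.prod_cons, hl'.2.2]
      have hJr : IsRegularIdeal J' := hI.mono (hp ▸ Ideal.mul_le_left)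
      have hlr : IsRegularIdeal l.prod := hI.mono (hp ▸ Ideal.mul_le_right)
      have hlr' : IsRegularIdeal l'.prod := hI.mono (hp' ▸ Ideal.mul_le_right)
      have heq : l.prod = l'.prod := h.eq_of_val_eq hlr hlr' fun M => by
        have := h.val_mul M hJr hlr
        have := h.val_mul M hJr hlr'
        rw [hp] at *
        rw [hp'] at *
        omega
      rw [ih hlr ⟨hl.1.of_cons, fun K hK => hl.2.1 K (List.mem_cons_of_mem _ hK), rfl⟩
        ⟨hl'.1.of_cons, fun K hK => hl'.2.1 K (List.mem_cons_of_mem _ hK), heq.symm⟩]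

/-- Induction on exponents: I = rad(I) · L, where L realises f - 1. The factors of L contain L,
hence I, hence rad(I), so the chain condition holds. -/
theorem exists_isRadicalChainFactorization (h : HasInvertibleRadicalIdeals R)
    (hI : IsRegularIdeal I) : ∃ l, IsRadicalChainFactorization I l := by
  refine uscCompactlySupported_induction (p := fun f => ∀ I : Ideal R, IsRegularIdeal I →
    (∀ M : MaxReg R, M.val I = f M) → ∃ l, IsRadicalChainFactorization I l) ?_ ?_
    (h.val_mem_uscCompactlySupported hI) I hI fun _ => rfl
  · intro I hI hv
    refine ⟨[], List.Pairwise.nil, fun J hJ => (List.not_mem_nil hJ).elim, ?_⟩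
    rw [List.prod_nil, Ideal.one_eq_top]
    exact h.eq_of_val_eq isRegularIdeal_top hI fun M => (h.val_top M).trans (hv M).symm
  · intro f hf ih I hI hv
    by_cases hItop : I = ⊤
    · refine ⟨[], List.Pairwise.nil, fun J hJ => (List.not_mem_nil hJ).elim, ?_⟩
      rw [List.prod_nil, Ideal.one_eq_top, hItop]
    obtain ⟨L, hL, hLv⟩ := h.exists_val_eq (sub_one_mem_uscCompactlySupported hf)
    obtain ⟨l, hchain, hl, hprod⟩ := ih L hL hLv
    have hIL : I ≤ L := (h.le_iff hI hL).2 fun M => by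
      rw [hLv, hv]
      exact Nat.sub_le _ _
    refine ⟨I.radical :: l, List.pairwise_cons.2 ⟨fun K hK => ?_, hchain⟩, ?_, ?_⟩
    · rw [(hl K hK).1.radical_le_iff]
      refine hIL.trans ?_
      rw [← hprod, ← Multiset.prod_coe]
      exact Ideal.multiset_prod_le_inf.trans (Multiset.inf_le (Multiset.mem_coe.2 hK))
    · intro K hK
      rcases List.mem_cons.1 hK with rfl | hK
      · exact ⟨Ideal.radical_isRadical I, fun ht => hItop (Ideal.radical_eq_top.1 ht)⟩
      · exact hl K hK
    · rw [List.prod_cons, hprod]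
      have hr : IsRegularIdeal I.radical := hI.mono Ideal.le_radical
      refine h.eq_of_val_eq (hr.mul hL) hI fun M => ?_
      rw [h.val_mul M hr hL, h.val_radical M hI, hLv, hv, add_comm]
      exact Nat.sub_add_min_cancel (f M) 1

end HasInvertibleRadicalIdeals

end Factorization

/-! ### The isomorphism with upper semicontinuous functions. -/

section Lattice

variable {R : Type*} [CommRing R]

open Classical in
/-- The valuations of a regular ideal, as an element of the ordered monoid of upper semicontinuous
functions with a bottom element, to which the zero ideal is sent. -/
noncomputable def HasInvertibleRadicalIdeals.toUscWithBot (h : HasInvertibleRadicalIdeals R)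
    (I : Ideal R) : UscWithBot (MaxReg R) :=
  if hI : IsRegularIdeal I then
    ((OrderDual.toDual ⟨fun M => M.val I, h.val_mem_uscCompactlySupported hI⟩ :
      (uscCompactlySupported (MaxReg R))ᵒᵈ) : UscWithBot (MaxReg R))
  else ⊥

namespace HasInvertibleRadicalIdeals

theorem toUscWithBot_of_isRegularIdeal (h : HasInvertibleRadicalIdeals R) {I : Ideal R}
    (hI : IsRegularIdeal I) : h.toUscWithBot I =
      ((OrderDual.toDual ⟨fun M => M.val I, h.val_mem_uscCompactlySupported hI⟩ :
        (uscCompactlySupported (MaxReg R))ᵒᵈ) : UscWithBot (MaxReg R)) :=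
  dif_pos hI

theorem toUscWithBot_bot [Nontrivial R] (h : HasInvertibleRadicalIdeals R) :
    h.toUscWithBot (⊥ : Ideal R) = ⊥ :=
  dif_neg not_isRegularIdeal_bot

theorem toUscWithBot_le_iff [Nontrivial R] (h : HasInvertibleRadicalIdeals R) {I J : Ideal R}
    (hI : I ∈ regularOrZeroIdeals R) (hJ : J ∈ regularOrZeroIdeals R) :
    h.toUscWithBot I ≤ h.toUscWithBot J ↔ I ≤ J := by
  rcases hI with hI | rfl
  · rcases hJ with hJ | rfl
    · rw [h.toUscWithBot_of_isRegularIdeal hI, h.toUscWithBot_of_isRegularIdeal hJ,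
        WithBot.coe_le_coe, h.le_iff hI hJ]
      exact Iff.rfl
    · rw [h.toUscWithBot_of_isRegularIdeal hI, h.toUscWithBot_bot]
      refine iff_of_false (WithBot.not_coe_le_bot _) fun hle => ?_
      exact not_isRegularIdeal_bot (hI.mono hle)
  · rw [h.toUscWithBot_bot]
    exact iff_of_true bot_le bot_le

theorem toUscWithBot_mul [Nontrivial R] (h : HasInvertibleRadicalIdeals R) {I J : Ideal R}
    (hI : I ∈ regularOrZeroIdeals R) (hJ : J ∈ regularOrZeroIdeals R) :
    h.toUscWithBot (I * J) = h.toUscWithBot I + h.toUscWithBot J := by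
  rcases hI with hI | rfl
  · rcases hJ with hJ | rfl
    · rw [h.toUscWithBot_of_isRegularIdeal hI, h.toUscWithBot_of_isRegularIdeal hJ,
        h.toUscWithBot_of_isRegularIdeal (hI.mul hJ), ← WithBot.coe_add]
      congr 1
      exact Subtype.ext (funext fun M => h.val_mul M hI hJ)
    · rw [Ideal.mul_bot, h.toUscWithBot_bot, WithBot.add_bot]
  · rw [Ideal.bot_mul, h.toUscWithBot_bot, WithBot.bot_add]

theorem exists_toUscWithBot_eq [Nontrivial R] (h : HasInvertibleRadicalIdeals R)
    (f : UscWithBot (MaxReg R)) : ∃ I ∈ regularOrZeroIdeals R, h.toUscWithBot I = f := by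
  induction f using WithBot.recBotCoe with
  | bot => exact ⟨⊥, Or.inr rfl, h.toUscWithBot_bot⟩
  | coe f =>
    obtain ⟨I, hI, hIf⟩ := h.exists_val_eq (OrderDual.ofDual f).2
    refine ⟨I, Or.inl hI, ?_⟩
    rw [h.toUscWithBot_of_isRegularIdeal hI]
    congr 1
    exact Subtype.ext (funext hIf)

/-- The lattice of regular ideals and the zero ideal is isomorphic to the ordered monoid of upper
semicontinuous functions with a bottom element. -/
noncomputable def orderMonoidIso [Nontrivial R] (h : HasInvertibleRadicalIdeals R) :
    regularOrZeroIdeals R ≃*o Multiplicative (UscWithBot (MaxReg R)) where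
  toEquiv := Equiv.ofBijective (fun I => Multiplicative.ofAdd (h.toUscWithBot I.1)) <| by
    refine ⟨fun I J hIJ => ?_, fun f => ?_⟩
    · have hIJ' : h.toUscWithBot I.1 = h.toUscWithBot J.1 := hIJ
      exact Subtype.ext (le_antisymm ((h.toUscWithBot_le_iff I.2 J.2).1 hIJ'.le)
        ((h.toUscWithBot_le_iff J.2 I.2).1 hIJ'.ge))
    · obtain ⟨I, hI, hIf⟩ := h.exists_toUscWithBot_eq f.toAdd
      exact ⟨⟨I, hI⟩, congrArg Multiplicative.ofAdd hIf⟩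
  map_mul' I J := congrArg Multiplicative.ofAdd (h.toUscWithBot_mul I.2 J.2)
  map_le_map_iff' {I J} := h.toUscWithBot_le_iff I.2 J.2

end HasInvertibleRadicalIdeals

/-- Order and multiplication alone detect radicality: if x² is in the ideal of f ≤ 1 and g
corresponds to that ideal plus (x), then f ≤ 2g pointwise forces f ≤ g, so x is in the ideal. Every
f is a finite sum of functions bounded by 1. -/
theorem isSPRing_of_orderMonoidIso [Nontrivial R]
    (e : regularOrZeroIdeals R ≃*o Multiplicative (UscWithBot (MaxReg R))) : IsSPRing R := by
  set φ : uscCompactlySupported (MaxReg R) → regularOrZeroIdeals R :=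
    fun f => e.symm (Multiplicative.ofAdd ((OrderDual.toDual f :
      (uscCompactlySupported (MaxReg R))ᵒᵈ) : UscWithBot (MaxReg R))) with hφ
  have hφ_mul : ∀ f g, φ (f + g) = φ f * φ g := fun f g => by
    rw [hφ, ← map_mul]; rfl
  have hφ_le : ∀ f g, φ f ≤ φ g ↔ g ≤ f := fun f g => by
    rw [hφ, map_le_map_iff]
    exact WithBot.coe_le_coe
  have hφ_surj : ∀ I : regularOrZeroIdeals R, IsRegularIdeal I.1 → ∃ f, φ f = I := by
    intro I hI
    rcases hf : (e I).toAdd with _ | f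
    · exfalso
      have hbot : I ≤ ⟨⊥, Or.inr rfl⟩ := by
        rw [← map_le_map_iff e]
        have : e I = Multiplicative.ofAdd ⊥ := hf
        rw [this]
        exact (bot_le : (⊥ : UscWithBot (MaxReg R)) ≤ _)
      exact not_isRegularIdeal_bot (hI.mono hbot)
    · refine ⟨OrderDual.ofDual f, ?_⟩
      have : e I = Multiplicative.ofAdd (f : UscWithBot (MaxReg R)) := hf
      exact (e.symm_apply_eq).2 this.symm
  have hφ_reg : ∀ f, IsRegularIdeal (φ f).1 := by
    intro f
    rcases (φ f).2 with hr | h0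
    · exact hr
    · exfalso
      have hle : φ f ≤ e.symm (Multiplicative.ofAdd ⊥) := by
        change (φ f).1 ≤ _
        rw [h0]; exact bot_le
      rw [hφ, map_le_map_iff] at hle
      exact WithBot.not_coe_le_bot _ hle
  have hφ_rad : ∀ f : uscCompactlySupported (MaxReg R), (∀ M, f.1 M ≤ 1) →
      (φ f).1.IsRadical := by
    intro f hf
    refine isRadical_of_sq_le fun x hx => ?_
    have hK : IsRegularIdeal ((φ f).1 ⊔ Ideal.span {x}) := (hφ_reg f).mono le_sup_left
    obtain ⟨g, hg⟩ := hφ_surj ⟨_, Or.inl hK⟩ hK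
    have h1 : φ g * φ g ≤ φ f := by
      rw [hg]
      change ((φ f).1 ⊔ Ideal.span {x}) * ((φ f).1 ⊔ Ideal.span {x}) ≤ (φ f).1
      rw [Ideal.sup_mul, Ideal.mul_sup, Ideal.mul_sup, Ideal.span_singleton_mul_span_singleton,
        ← sq x]
      exact sup_le (sup_le Ideal.mul_le_left Ideal.mul_le_left)
        (sup_le Ideal.mul_le_right ((Ideal.span_singleton_le_iff_mem _).2 hx))
    rw [← hφ_mul, hφ_le] at h1
    have h2 : φ g ≤ φ f := (hφ_le g f).2 fun M => by
      have h3 : f.1 M ≤ g.1 M + g.1 M := h1 M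
      have := hf M
      show f.1 M ≤ g.1 M
      omega
    rw [hg] at h2
    exact h2 (Ideal.mem_sup_right (Ideal.mem_span_singleton_self x))
  intro I hI
  obtain ⟨f, hf⟩ := hφ_surj ⟨I, Or.inl hI⟩ hI
  have key : ∀ hf' : f.1 ∈ uscCompactlySupported (MaxReg R),
      IsProductOfRadicalIdeals (φ ⟨f.1, hf'⟩).1 := by
    refine uscCompactlySupported_induction (p := fun f => ∀ hf, IsProductOfRadicalIdeals
      (φ ⟨f, hf⟩).1) ?_ ?_ f.2
    · exact fun hf => ⟨{(φ ⟨_, hf⟩).1}, fun J hJ => Multiset.mem_singleton.1 hJ ▸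
        hφ_rad _ fun M => zero_le_one, Multiset.prod_singleton _⟩
    · intro f hf ih _
      obtain ⟨s, hs, hsf⟩ := ih (sub_one_mem_uscCompactlySupported hf)
      refine ⟨(φ ⟨_, min_one_mem_uscCompactlySupported hf⟩).1 ::ₘ s, fun J hJ => ?_, ?_⟩
      · rcases Multiset.mem_cons.1 hJ with rfl | hJ
        · exact hφ_rad _ fun M => min_le_right _ _
        · exact hs J hJ
      · rw [Multiset.prod_cons, hsf, ← Submonoid.coe_mul, ← hφ_mul]
        congr 2
        refine Subtype.ext (funext fun M => ?_)
        exact (add_comm _ _).trans (Nat.sub_add_min_cancel (f M) 1)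
  have := key f.2
  rwa [Subtype.coe_eta, hf] at this

end Lattice

theorem theorem7p4 {R : Type*} [CommRing R] [Nontrivial R]
    (hR : ∀ I : Ideal R, IsRegularIdeal I → IsSumOfInvertibleIdeals I) :
    List.TFAE
      [ IsSPRing R,
        ∀ I : Ideal R, IsRegularIdeal I →
          ∃! l : List (Ideal R), IsRadicalChainFactorization I l,
        (∀ P : Ideal R, P.IsPrime → IsRegularIdeal P → P.IsMaximal) ∧
          ∀ I : Ideal R, IsInvertibleIdeal I → IsProductOfRadicalIdeals I,
        ∀ P : Ideal R, P.IsPrime → IsRegularIdeal P →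
          P.IsMaximal ∧ ∃ J : Ideal R, J ≤ P ∧ IsInvertibleIdeal J ∧ J.IsRadical,
        ∀ I : Ideal R, I.FG → IsRegularIdeal I → IsInvertibleIdeal I.radical,
        -- an isomorphism of ordered monoids, with `U_b` written multiplicatively
        Nonempty (regularOrZeroIdeals R ≃*o Multiplicative (UscWithBot (MaxReg R))),
        IsPruferRing R ∧
          ∀ I : Ideal R, I.FG → IsRegularIdeal I → I.radical.FG ] := by
  tfae_have 1 → 3 := fun h =>
    ⟨fun P hP hPr => h.isMaximal_of_isPrime hP hPr, fun I hI => h I hI.isRegularIdeal⟩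
  tfae_have 3 → 4 := by
    rintro ⟨hmax, hprod⟩ P hP hPr
    obtain ⟨x, hx, hx0⟩ := id hPr
    exact ⟨hmax P hP hPr, exists_isRadical_isInvertibleIdeal_le hP hx hx0
      (hprod _ (isInvertibleIdeal_span_singleton hx0))⟩
  tfae_have 4 → 2 := by
    intro (h : HasInvertibleRadicalIdeals R) I hI
    obtain ⟨l, hl⟩ := h.exists_isRadicalChainFactorization hI
    exact ⟨l, hl, fun l' hl' => h.isRadicalChainFactorization_unique hI hl' hl⟩
  tfae_have 2 → 1 := fun h I hI =>
    let ⟨_, hl, _⟩ := h I hI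
    hl.isProductOfRadicalIdeals
  tfae_have 4 → 6 := fun h => ⟨HasInvertibleRadicalIdeals.orderMonoidIso h⟩
  tfae_have 6 → 1 := fun ⟨e⟩ => isSPRing_of_orderMonoidIso e
  tfae_have 4 → 7 := by
    intro (h : HasInvertibleRadicalIdeals R)
    exact ⟨h.isPruferRing, fun I hfg hI => (h.isInvertibleIdeal_radical hfg hI).fg⟩
  tfae_have 7 → 5 := fun h I hfg hI => h.1 _ (h.2 I hfg hI) (hI.mono Ideal.le_radical)
  tfae_have 5 → 4 := hasInvertibleRadicalIdeals_of_isInvertibleIdeal_radical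
  tfae_finish
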